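/- Let $\mathcal G$ be a distributed interactive Markov chain with players $\mathrm{Plr}=\{1,\dots,n\}$: for each player $j$ a module with a finite state space $S_j$, an initial state $s^{in}_j$, a finite action set $\mathrm{Act}_j$, action transitions $\to_j\subseteq S_j\times \mathrm{Act}_j\times S_j$, and a finite set of delay transitions in $S_j\times\mathbb Q_{>0}\times S_j$ (source, rate, target). Let $\mathrm{Act}=\bigcup_j \mathrm{Act}_j$, and let $\mathrm{Sync}(a)=\{j : a\in \mathrm{Act}_j\}$ for an action $a$ and $\mathrm{Sync}(j)=\{j\}$ for a player $j$. Assume that for every $a\in\mathrm{Act}$ there is $j\in\mathrm{Sync}(a)$ such that the labelled transition system $(S_j,\to_j)$ has no cycle containing an $a$-transition. A choice of player $j$ available in a state $s\in S_j$ is an action transition leaving $s$, or $\bot$ if there is none. An action $a$ is enabled in a global choice $\mathbf c$ (a tuple of choices, one for each player) if every $j\in\mathrm{Sync}(a)$ has chosen an $a$-transition. A play is a sequence $\rho=\mathbf s_0\mathbf c_0\xrightarrow{a_1,t_1}\mathbf s_1\mathbf c_1\xrightarrow{a_2,t_2}\cdots$ of global states, global choices available in them, labels $a_i\in\mathrm{Act}\cup\mathrm{Plr}$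 and absolute times $t_i$ (with $t_0=0$) that starts in the initial state and follows these rules. If some action is enabled in $\mathbf c_i$, then $a_{i+1}$ is an enabled action, $t_{i+1}=t_i$, and exactly the players in $\mathrm{Sync}(a_{i+1})$ move, each to the target of its choice. If no action is enabled, then one player $a_{i+1}=\ell$ takes a delay transition leaving its local state, and $t_{i+1}\ge t_i$. Players outside $\mathrm{Sync}(a_{i+1})$ keep their state and their choice. A play is infinite unless it reaches a point at which no action is enabled and no local state has a delay transition, where it stops. Sets of plays are measurable with respect to the $\sigma$-algebra generated by the coordinates. A history is a finite prefix of a play ending with a state. The local history (local play) $\pi_j$ of player $j$ is obtained from a history (play) by deleting all steps $\xrightarrow{a_m,t_m}\mathbf s_m\mathbf c_m$ with $j\notin\mathrm{Sync}(a_m)$ and replacing global states and choices by those of $j$. A strategy $\sigma_j$ of player $j$ assigns measurably to each local history of $j$ a probability distribution on the choices available in its last state. A scheduler $\delta$ assigns measurably to each history and each global choice a probability distribution on the actions enabled in that choice, or $\bot$ if there are none. For a strategy profile $\boldsymbol\sigma=(\sigma_1,\dots,\sigma_n)$ and a scheduler $\delta$, let $\Pr^{\boldsymbol\sigma,\delta}$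 be the law of the random play in which - initially all players, and after each transition with label $a$ the players in $\mathrm{Sync}(a)$, draw new choices independently of each other according to their strategies applied to their current local histories; - if some action is enabled, the next action is drawn according to $\delta$; - otherwise every delay transition leaving a current local state is assigned an independent, exponentially distributed delay with its rate, and the transition with the minimal delay $d$ is taken, $d$ time units later. Call plays $\rho,\rho'$ locally observation equivalent if $\pi_j(\rho)=\pi_j(\rho')$ for all $j\in\mathrm{Plr}$. **Theorem.** Let $E$ be a measurable set of plays that is closed under local observation equivalence, i.e. $\rho'\in E$ for all $\rho\in E$ and all plays $\rho'$ that are locally observation equivalent to $\rho$. Then for every strategy profile $\boldsymbol\sigma$ and all schedulers $\delta,\delta'$, $$\Pr\nolimits^{\boldsymbol\sigma,\delta}(E)=\Pr\nolimits^{\boldsymbol\sigma,\delta'}(E).$$ -/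

import Mathlib

open MeasureTheory ProbabilityTheory

universe u v

/-- An interactive Markov chain (module) with actions taken from `α`. -/
structure IMC (α : Type v) where
  State : Type u
  finite_state : Finite State
  init : State
  actions : Finset α
  trans : Finset (State × α × State)
  trans_action : ∀ x ∈ trans, x.2.1 ∈ actions
  delays : Finset (State × ℚ × State)
  rate_pos : ∀ x ∈ delays, 0 < x.2.1

namespace IMC

variable {α : Type v} (M : IMC.{u, v} α)

instance : Finite M.State := M.finite_state
instance : MeasurableSpace M.State := ⊤
instance : DiscreteMeasurableSpace M.State := ⟨fun _ => trivial⟩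
instance : Inhabited M.State := ⟨M.init⟩

/-- Some action transition leads from `s` to `s'`. -/
def Step (s s' : M.State) : Prop := ∃ a, (s, a, s') ∈ M.trans

/-- The labelled transition system of the action transitions has a cycle with an `a`-transition. -/
def HasCycleThrough (a : α) : Prop :=
  ∃ s s', (s, a, s') ∈ M.trans ∧ Relation.ReflTransGen M.Step s' s

/-- Local choices: an action transition, or `none`, which stands for `⊥`. -/
def Choice : Type (max u v) := Option {x : M.State × α × M.State // x ∈ M.trans}

instance : Finite M.Choice :=
  inferInstanceAs (Finite (Option {x : M.State × α × M.State // x ∈ M.trans}))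
instance : MeasurableSpace M.Choice := ⊤
instance : DiscreteMeasurableSpace M.Choice := ⟨fun _ => trivial⟩
instance : Inhabited M.Choice := ⟨(none : Option _)⟩

variable {M}

/-- The choice is a transition with action `a`. -/
def Choice.HasAction (c : M.Choice) (a : α) : Prop :=
  match c with
  | none => False
  | some x => x.1.2.1 = a

/-- The target of the chosen transition; a player that chose `⊥` in state `s` stays there. -/
def Choice.target (c : M.Choice) (s : M.State) : M.State :=
  match c with
  | none => s
  | some x => x.1.2.2

/-- The choice is available in `s`: an action transition that leaves `s`, or `⊥` if there is
none. -/
def Choice.Available (c : M.Choice) (s : M.State) : Prop :=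
  match c with
  | none => ∀ a s', (s, a, s') ∉ M.trans
  | some x => x.1.1 = s

end IMC

section Lists

variable {X Y Z : Type*}

/-- Finite sequences carry the disjoint union of the product `σ`-algebras of all lengths. -/
instance List.instMeasurableSpaceSeq [MeasurableSpace X] : MeasurableSpace (List X) :=
  ⨅ k : ℕ, MeasurableSpace.map (fun w : Fin k → X => List.ofFn w) MeasurableSpace.pi

theorem measurableSet_list_iff [MeasurableSpace X] {A : Set (List X)} :
    MeasurableSet A ↔ ∀ k : ℕ, MeasurableSet ((fun w : Fin k → X => List.ofFn w) ⁻¹' A) := by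
  unfold List.instMeasurableSpaceSeq
  rw [MeasurableSpace.measurableSet_iInf]
  rfl

theorem measurable_list_iff [MeasurableSpace X] [MeasurableSpace Y] {f : List X → Y} :
    Measurable f ↔ ∀ k : ℕ, Measurable (fun w : Fin k → X => f (List.ofFn w)) := by
  constructor
  · intro hf k A hA
    exact measurableSet_list_iff.1 (hf hA) k
  · intro h A hA
    exact measurableSet_list_iff.2 fun k => h k hA

theorem measurable_ofFn [MeasurableSpace X] (k : ℕ) :
    Measurable (fun w : Fin k → X => List.ofFn w) := fun _ hA => measurableSet_list_iff.1 hA k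

theorem measurable_list_prod [Inhabited X] [MeasurableSpace X] [MeasurableSpace Y]
    [MeasurableSpace Z] {f : List X × Z → Y}
    (h : ∀ k : ℕ, Measurable (fun q : (Fin k → X) × Z => f (List.ofFn q.1, q.2))) :
    Measurable f := by
  intro A hA
  have hv : ∀ k : ℕ, Measurable (fun l : List X => fun i : Fin k => l.getD i default) := by
    intro k
    refine measurable_pi_iff.2 fun i => measurable_list_iff.2 fun m => ?_
    by_cases hi : (i : ℕ) < m
    · have : (fun w : Fin m → X => (List.ofFn w).getD i default) = fun w => w ⟨i, hi⟩ := by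
        funext w
        simp [List.getD, hi]
      rw [this]
      exact measurable_pi_apply _
    · have : (fun w : Fin m → X => (List.ofFn w).getD i default) = fun _ => default := by
        funext w
        simp [List.getD, hi]
      rw [this]
      exact measurable_const
  have hlen : Measurable (fun l : List X => l.length) := by
    refine measurable_list_iff.2 fun m => ?_
    simp
  have : f ⁻¹' A = ⋃ k : ℕ, ((fun q : List X × Z => q.1.length) ⁻¹' {k}) ∩
      ((fun q : List X × Z => ((fun i : Fin k => q.1.getD i default), q.2)) ⁻¹'
        ((fun q : (Fin k → X) × Z => f (List.ofFn q.1, q.2)) ⁻¹' A)) := by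
    ext ⟨l, z⟩
    have key : List.ofFn (fun i : Fin l.length => l.getD i default) = l := by
      apply List.ext_getElem <;> simp
    simp only [Set.mem_preimage, Set.mem_iUnion, Set.mem_inter_iff, Set.mem_singleton_iff,
      exists_eq_left']
    rw [key]
  rw [this]
  refine MeasurableSet.iUnion fun k => ?_
  refine ((hlen.comp measurable_fst) (measurableSet_singleton k)).inter ?_
  exact (((hv k).comp measurable_fst).prodMk measurable_snd) (h k hA)

theorem measurable_snoc [Inhabited X] [MeasurableSpace X] :
    Measurable (fun q : List X × X => q.1 ++ [q.2]) := by
  refine measurable_list_prod fun k => ?_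
  have : (fun q : (Fin k → X) × X => List.ofFn q.1 ++ [q.2]) =
      fun q => List.ofFn (Fin.snoc q.1 q.2 : Fin (k + 1) → X) := by
    funext q
    rw [List.ofFn_succ']
    simp
  rw [this]
  refine (measurable_ofFn (k + 1)).comp (measurable_pi_iff.2 fun i => ?_)
  refine Fin.lastCases ?_ (fun i => ?_) i
  · simpa using measurable_snd
  · simpa using measurable_fst.eval

theorem measurable_filterMap [MeasurableSpace X] [Inhabited Y] [MeasurableSpace Y]
    {p : X → Prop} [DecidablePred p] (hp : MeasurableSet {x | p x}) {g : X → Y}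
    (hg : Measurable g) :
    Measurable (fun l : List X => l.filterMap fun x => if p x then some (g x) else none) := by
  refine measurable_list_iff.2 fun k => ?_
  induction k with
  | zero => simp
  | succ k ih =>
    have : (fun w : Fin (k + 1) → X =>
        (List.ofFn w).filterMap fun x => if p x then some (g x) else none) =
        fun w => if p (w (Fin.last k)) then
          ((List.ofFn fun i : Fin k => w i.castSucc).filterMap
            fun x => if p x then some (g x) else none) ++ [g (w (Fin.last k))]
          else (List.ofFn fun i : Fin k => w i.castSucc).filterMap
            fun x => if p x then some (g x) else none := by
      funext w
      rw [List.ofFn_succ']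
      by_cases h : p (w (Fin.last k)) <;> simp [h, List.filterMap_append]
    rw [this]
    have h1 : Measurable (fun w : Fin (k + 1) → X =>
        (List.ofFn fun i : Fin k => w i.castSucc).filterMap
          fun x => if p x then some (g x) else none) :=
      ih.comp (measurable_pi_iff.2 fun i => measurable_pi_apply i.castSucc)
    refine Measurable.ite ((measurable_pi_apply (Fin.last k)) hp) ?_ h1
    exact measurable_snoc.comp (h1.prodMk (hg.comp (measurable_pi_apply _)))

end Lists

/-- A distributed IMC: one module for each of the players `0, …, n - 1`. -/
structure DistributedIMC (n : ℕ) (α : Type v) where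
  comp : Fin n → IMC.{u, v} α

namespace DistributedIMC

variable {n : ℕ} {α : Type v} (G : DistributedIMC.{u, v} n α)

/-- The union of the action sets of the modules. -/
def Action : Type v := {a : α // ∃ j, a ∈ (G.comp j).actions}

instance : Finite G.Action := by
  have : {a : α | ∃ j, a ∈ (G.comp j).actions} = ⋃ j, ((G.comp j).actions : Set α) := by
    ext a
    simp
  have hf : {a : α | ∃ j, a ∈ (G.comp j).actions}.Finite := by
    rw [this]
    exact Set.finite_iUnion fun j => Finset.finite_toSet _
  exact hf.to_subtype

instance : MeasurableSpace G.Action := ⊤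
instance : DiscreteMeasurableSpace G.Action := ⟨fun _ => trivial⟩

/-- Transitions are labelled by actions and, for delay transitions, by players. -/
abbrev Label : Type v := G.Action ⊕ Fin n

/-- The label of the last transition; `none` if no transition has been taken, because the play
has just started or has stopped. -/
def Event : Type v := Option G.Label

instance : Finite G.Event := inferInstanceAs (Finite (Option G.Label))
instance : MeasurableSpace G.Event := ⊤
instance : DiscreteMeasurableSpace G.Event := ⟨fun _ => trivial⟩
instance : Inhabited G.Event := ⟨(none : Option _)⟩

variable {G} in
/-- The event that the action `a` is taken. -/
def actionEvent (a : G.Action) : G.Event := (some (Sum.inl a) : Option _)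

/-- The event that player `j` takes a delay transition. -/
def delayEvent (j : Fin n) : G.Event := (some (Sum.inr j) : Option _)

/-- No transition. -/
def noEvent : G.Event := (none : Option _)

variable {G} in
/-- The players that take part in a transition. -/
def sync (e : G.Event) : Set (Fin n) :=
  match e with
  | none => ∅
  | some (Sum.inl a) => {j | a.1 ∈ (G.comp j).actions}
  | some (Sum.inr j) => {j}

/-- For each action one of the players sharing it has no cycle of action transitions through it. -/
def NoActionCycles : Prop :=
  ∀ a : G.Action, ∃ j ∈ sync (actionEvent a), ¬ (G.comp j).HasCycleThrough a.1

/-- Global states. -/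
abbrev GState : Type u := ∀ j, (G.comp j).State

/-- Global choices. -/
abbrev GChoice : Type (max u v) := ∀ j, (G.comp j).Choice

/-- The initial global state. -/
def gInit : G.GState := fun j => (G.comp j).init

variable {G} in
/-- The actions enabled in a global choice. -/
def enabled (c : G.GChoice) : Set G.Action :=
  {a | ∀ j ∈ sync (actionEvent a), (c j).HasAction a.1}

/-- The delay transitions leaving the local states of `s`: a player, a rate and a target. -/
abbrev DelayTrans (s : G.GState) : Type u :=
  Σ j : Fin n, {x : ℚ × (G.comp j).State // (s j, x.1, x.2) ∈ (G.comp j).delays}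

instance (s : G.GState) : Finite (G.DelayTrans s) := by
  have (j : Fin n) :
      Finite {x : ℚ × (G.comp j).State // (s j, x.1, x.2) ∈ (G.comp j).delays} := by
    refine Finite.of_injective (β := (G.comp j).delays)
      (fun x => ⟨(s j, x.1.1, x.1.2), x.2⟩) fun x y h => ?_
    simpa [Subtype.ext_iff, Prod.ext_iff] using h
  infer_instance

noncomputable instance (s : G.GState) : Fintype (G.DelayTrans s) := Fintype.ofFinite _
instance (s : G.GState) : MeasurableSpace (G.DelayTrans s) := ⊤
instance (s : G.GState) : DiscreteMeasurableSpace (G.DelayTrans s) := ⟨fun _ => trivial⟩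

/-- The label of a transition, its absolute time and the global state that it leads to. -/
abbrev Obs : Type (max u v) := G.Event × ℝ × G.GState

/-- One step `c →[a, t] s` of a history: global choice, label, absolute time, next state. -/
abbrev HStep : Type (max u v) := G.GChoice × G.Obs

/-- Global histories `s₀ c₀ →[a₁, t₁] s₁ c₁ ⋯ →[aᵢ, tᵢ] sᵢ`: the first state and the steps. -/
abbrev Hist : Type (max u v) := G.GState × List G.HStep

/-- Local histories of player `j`. -/
abbrev LocalHist (j : Fin n) : Type (max u v) :=
  (G.comp j).State × List ((G.comp j).Choice × G.Event × ℝ × (G.comp j).State)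

variable {G}

/-- The last state of a history. -/
def Hist.last (h : G.Hist) : G.GState := (h.2.getLast?).elim h.1 fun x => x.2.2.2

/-- The time of the last transition of a history. -/
def Hist.time (h : G.Hist) : ℝ := (h.2.getLast?).elim 0 fun x => x.2.2.1

/-- The players involved in the last transition of a history; all players at the start. -/
def Hist.active (h : G.Hist) : Set (Fin n) :=
  (h.2.getLast?).elim Set.univ fun x => sync x.2.1

/-- The last state of a local history. -/
def LocalHist.last {j : Fin n} (h : G.LocalHist j) : (G.comp j).State :=
  (h.2.getLast?).elim h.1 fun x => x.2.2.2

open Classical in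
/-- The local history of player `j`: the steps not visible for `j` are left out. As a player keeps
its choice until the next transition it is involved in, the choice recorded with that transition is
the one that was made after the previous visible one. -/
noncomputable def Hist.local (j : Fin n) (h : G.Hist) : G.LocalHist j :=
  (h.1 j, h.2.filterMap fun x =>
    if j ∈ sync x.2.1 then some (x.1 j, x.2.1, x.2.2.1, x.2.2.2 j) else none)

/-- Appending a step. -/
def Hist.extend (h : G.Hist) (c : G.GChoice) (o : G.Obs) : G.Hist := (h.1, h.2 ++ [(c, o)])

variable (G)

/-- A strategy of player `j`. -/
structure Strategy (j : Fin n) where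
  dist : G.LocalHist j → PMF (G.comp j).Choice
  measurable : ∀ c, Measurable fun h => dist h c
  available : ∀ h, ∀ c ∈ (dist h).support, c.Available h.last

/-- A scheduler; the value `none` stands for `⊥`. -/
structure Scheduler where
  dist : G.Hist → G.GChoice → Option (PMF G.Action)
  measurable : ∀ c a, Measurable fun h => (dist h c).elim 0 fun p => p a
  eq_none_iff : ∀ h c, dist h c = none ↔ enabled c = ∅
  mem_enabled : ∀ h c p, dist h c = some p → ∀ a ∈ p.support, a ∈ enabled c

variable {G}

open Classical in
/-- The next global choice: independently, the players involved in the last transition choose by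
their strategies, and the others keep the previous choice `c`. -/
noncomputable def choiceLaw (σ : ∀ j, G.Strategy j) (h : G.Hist) (c : G.GChoice) :
    Measure G.GChoice :=
  Measure.pi fun j =>
    if j ∈ h.active then ((σ j).dist (h.local j)).toMeasure else Measure.dirac (c j)

open Classical in
/-- The state after action `a` is taken in state `s` under the choice `c`. -/
noncomputable def move (c : G.GChoice) (a : G.Action) (s : G.GState) : G.GState :=
  fun j => if j ∈ sync (actionEvent a) then (c j).target (s j) else s j

/-- A delay transition whose delay is minimal; ties have probability zero. -/
noncomputable def winner {s : G.GState} [Nonempty (G.DelayTrans s)] (d : G.DelayTrans s → ℝ) :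
    G.DelayTrans s :=
  Classical.epsilon fun e => ∀ e', d e ≤ d e'

/-- The delay transition that wins the race with delays `d`, started in `s` at time `t`. -/
noncomputable def delayObs (s : G.GState) [Nonempty (G.DelayTrans s)] (t : ℝ)
    (d : G.DelayTrans s → ℝ) : G.Obs :=
  (G.delayEvent (winner d).1, t + d (winner d), Function.update s (winner d).1 (winner d).2.1.2)

open Classical in
/-- The next transition after `h` when the current choice is `c`: an action drawn by the scheduler
if there is an enabled one; otherwise the winner of a race of independent, exponentially
distributed delays, one for each delay transition of the current local states. If there is neither,
the play stops, which is represented by repeating time and state forever. -/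
noncomputable def transLaw (δ : G.Scheduler) (h : G.Hist) (c : G.GChoice) : Measure G.Obs :=
  match δ.dist h c with
  | some p => p.toMeasure.map fun a => (actionEvent a, h.time, move c a h.last)
  | none =>
    if _h : Nonempty (G.DelayTrans h.last) then
      (Measure.pi fun e : G.DelayTrans h.last => expMeasure (e.2.1.1 : ℝ)).map
        (delayObs h.last h.time)
    else Measure.dirac (G.noEvent, h.time, h.last)


/-! Measurability of the one-step laws. -/

instance : DiscreteMeasurableSpace G.GState := MeasurableSingletonClass.toDiscreteMeasurableSpace
instance : DiscreteMeasurableSpace G.GChoice := MeasurableSingletonClass.toDiscreteMeasurableSpace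

theorem measurable_hist {Y : Type*} [MeasurableSpace Y] {f : G.Hist → Y}
    (h : ∀ s (k : ℕ), Measurable fun w : Fin k → G.HStep => f (s, List.ofFn w)) :
    Measurable f :=
  measurable_from_prod_countable_right fun s => measurable_list_iff.2 fun k => h s k

theorem measurable_getLast_elim {Y : Type*} [MeasurableSpace Y] {g : G.GState → Y}
    {f : G.HStep → Y} (hf : Measurable f) :
    Measurable fun h : G.Hist => (h.2.getLast?).elim (g h.1) f := by
  refine measurable_hist fun s k => ?_
  cases k with
  | zero => simp
  | succ k =>
    have : (fun w : Fin (k + 1) → G.HStep => ((List.ofFn w).getLast?).elim (g s) f) =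
        fun w => f (w (Fin.last k)) := by
      funext w
      rw [List.ofFn_succ']
      simp
    simp only [this]
    exact hf.comp (measurable_pi_apply _)

theorem measurable_last : Measurable (Hist.last : G.Hist → G.GState) :=
  measurable_getLast_elim (g := fun s => s) (by fun_prop)

theorem measurable_time : Measurable (Hist.time : G.Hist → ℝ) :=
  measurable_getLast_elim (g := fun _ => (0 : ℝ)) (by fun_prop)

theorem measurableSet_active (j : Fin n) : MeasurableSet {h : G.Hist | j ∈ h.active} := by
  have : Measurable fun h : G.Hist => (h.2.getLast?).elim True fun x => j ∈ sync x.2.1 :=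
    measurable_getLast_elim (g := fun _ => True)
      ((Measurable.of_discrete (f := fun e : G.Event => j ∈ sync e)).comp (by fun_prop))
  convert measurableSet_setOfPred.2 this using 3 with h
  unfold Hist.active
  cases h.2.getLast? <;> simp

theorem measurable_local (j : Fin n) :
    Measurable (Hist.local j : G.Hist → G.LocalHist j) := by
  classical
  refine Measurable.prodMk ((measurable_pi_apply j).comp measurable_fst) ?_
  refine Measurable.comp (g := fun l : List G.HStep => l.filterMap fun x =>
    if j ∈ sync x.2.1 then some (x.1 j, x.2.1, x.2.2.1, x.2.2.2 j) else none) ?_ measurable_snd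
  convert measurable_filterMap (X := G.HStep) (p := fun x => j ∈ sync x.2.1)
    (g := fun x => (x.1 j, x.2.1, x.2.2.1, x.2.2.2 j)) ?_ ?_
  · exact (Set.toFinite {e : G.Event | j ∈ sync e}).measurableSet.preimage
      (measurable_fst.comp measurable_snd)
  · fun_prop

theorem measurable_extend :
    Measurable fun q : (G.Hist × G.GChoice) × G.Obs => q.1.1.extend q.1.2 q.2 := by
  refine Measurable.prodMk (by fun_prop) ?_
  exact measurable_snoc.comp
    (f := fun q : (G.Hist × G.GChoice) × G.Obs => (q.1.1.2, (q.1.2, q.2))) (by fun_prop)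

instance (σ : ∀ j, G.Strategy j) (h : G.Hist) (c : G.GChoice) :
    IsProbabilityMeasure (choiceLaw σ h c) := by
  classical
  unfold choiceLaw
  have (j : Fin n) : IsProbabilityMeasure
      (if j ∈ h.active then ((σ j).dist (h.local j)).toMeasure else Measure.dirac (c j)) := by
    split_ifs <;> infer_instance
  infer_instance

theorem measurable_choiceLaw (σ : ∀ j, G.Strategy j) :
    Measurable fun q : G.Hist × G.GChoice => choiceLaw σ q.1 q.2 := by
  classical
  refine measurable_from_prod_countable_left fun c => ?_
  refine Measure.measurable_of_measurable_coe _ fun A _ => ?_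
  have hfin : A.Finite := Set.toFinite A
  have : (fun h : G.Hist => choiceLaw σ h c A) = fun h : G.Hist =>
      ∑ c' ∈ hfin.toFinset, choiceLaw σ h c {c'} := by
    funext h
    rw [sum_measure_singleton]
    simp
  simp only [this]
  refine Finset.measurable_sum _ fun c' _ => ?_
  have : (fun h : G.Hist => choiceLaw σ h c {c'}) = fun h : G.Hist =>
      ∏ j, if j ∈ h.active then (σ j).dist (h.local j) (c' j)
        else Measure.dirac (c j) {c' j} := by
    funext h
    have (j : Fin n) : SigmaFinite
        (if j ∈ h.active then ((σ j).dist (h.local j)).toMeasure else Measure.dirac (c j)) := by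
      split_ifs <;> infer_instance
    unfold choiceLaw
    rw [Measure.pi_singleton]
    refine Finset.prod_congr rfl fun j _ => ?_
    split_ifs
    · rw [PMF.toMeasure_apply_singleton _ _ (measurableSet_singleton _)]
    · rfl
  rw [this]
  refine Finset.measurable_prod _ fun j _ => ?_
  exact Measurable.ite (measurableSet_active j)
    (((σ j).measurable _).comp (measurable_local j)) measurable_const

theorem measurable_winner {s : G.GState} [Nonempty (G.DelayTrans s)] :
    Measurable (winner : (G.DelayTrans s → ℝ) → G.DelayTrans s) := by
  have h1 : Measurable fun d : G.DelayTrans s → ℝ => fun e => ∀ e', d e ≤ d e' := by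
    refine measurable_pi_iff.2 fun e => ?_
    refine measurableSet_setOfPred.1 ?_
    simp only [Set.ofPred_forall]
    exact MeasurableSet.iInter fun e' =>
      measurableSet_le (measurable_pi_apply e) (measurable_pi_apply e')
  have : DiscreteMeasurableSpace (G.DelayTrans s → Prop) :=
    MeasurableSingletonClass.toDiscreteMeasurableSpace
  exact (Measurable.of_discrete
    (f := fun P : G.DelayTrans s → Prop => Classical.epsilon P)).comp h1

theorem measurable_delayObs (s : G.GState) [Nonempty (G.DelayTrans s)] :
    Measurable fun q : ℝ × (G.DelayTrans s → ℝ) => delayObs s q.1 q.2 := by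
  have hw : Measurable fun q : ℝ × (G.DelayTrans s → ℝ) => winner q.2 :=
    measurable_winner.comp measurable_snd
  refine Measurable.prodMk ((Measurable.of_discrete
    (f := fun e : G.DelayTrans s => G.delayEvent e.1)).comp hw) (Measurable.prodMk ?_ ?_)
  · refine measurable_fst.add ?_
    have : Measurable fun r : (G.DelayTrans s → ℝ) × G.DelayTrans s => r.1 r.2 :=
      measurable_from_prod_countable_left fun e => measurable_pi_apply e
    exact this.comp (measurable_snd.prodMk hw)
  · exact (Measurable.of_discrete
      (f := fun e : G.DelayTrans s => Function.update s e.1 e.2.1.2)).comp hw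

instance (s : G.GState) (e : G.DelayTrans s) :
    IsProbabilityMeasure (expMeasure (e.2.1.1 : ℝ)) :=
  isProbabilityMeasure_expMeasure (by exact_mod_cast (G.comp e.1).rate_pos _ e.2.2)

instance (δ : G.Scheduler) (h : G.Hist) (c : G.GChoice) :
    IsProbabilityMeasure (transLaw δ h c) := by
  unfold transLaw
  split
  · exact Measure.isProbabilityMeasure_map Measurable.of_discrete.aemeasurable
  · split_ifs with hne
    · exact Measure.isProbabilityMeasure_map
        ((measurable_delayObs h.last).comp measurable_prodMk_left).aemeasurable
    · infer_instance

theorem measurable_transLaw (δ : G.Scheduler) :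
    Measurable fun q : G.Hist × G.GChoice => transLaw δ q.1 q.2 := by
  classical
  refine measurable_from_prod_countable_left fun c => ?_
  by_cases hc : enabled c = ∅
  · have hloc : ∀ s : G.GState, Measurable fun t : ℝ =>
        if _h : Nonempty (G.DelayTrans s) then
          (Measure.pi fun e : G.DelayTrans s => expMeasure (e.2.1.1 : ℝ)).map (delayObs s t)
        else Measure.dirac (G.noEvent, t, s) := by
      intro s
      by_cases hne : Nonempty (G.DelayTrans s)
      · simp only [hne, dif_pos]
        refine Measure.measurable_of_measurable_coe _ fun A hA => ?_
        have : (fun t : ℝ => (Measure.pi fun e : G.DelayTrans s =>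
            expMeasure (e.2.1.1 : ℝ)).map (delayObs s t) A) =
            fun t => (Measure.pi fun e : G.DelayTrans s => expMeasure (e.2.1.1 : ℝ))
              (Prod.mk t ⁻¹' ((fun q : ℝ × (G.DelayTrans s → ℝ) => delayObs s q.1 q.2) ⁻¹' A)) := by
          funext t
          have hm : Measurable (delayObs s t) :=
            (measurable_delayObs s).comp measurable_prodMk_left
          rw [Measure.map_apply hm hA]
          rfl
        rw [this]
        exact measurable_measure_prodMk_left (measurable_delayObs s hA)
      · simp only [hne, dif_neg, not_false_iff]
        exact Measure.measurable_dirac.comp (by fun_prop)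
    have hglue := measurable_from_prod_countable_right
      (f := fun q : G.GState × ℝ =>
        if _h : Nonempty (G.DelayTrans q.1) then
          (Measure.pi fun e : G.DelayTrans q.1 => expMeasure (e.2.1.1 : ℝ)).map
            (delayObs q.1 q.2)
        else Measure.dirac (G.noEvent, q.2, q.1)) hloc
    convert hglue.comp (measurable_last.prodMk measurable_time) using 2 with h
    simp only [transLaw, (δ.eq_none_iff h c).2 hc]
    rfl
  · refine Measure.measurable_of_measurable_coe _ fun A hA => ?_
    have : Fintype G.Action := Fintype.ofFinite _
    have : (fun h : G.Hist => transLaw δ h c A) = fun h : G.Hist =>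
        ∑ a : G.Action, if (actionEvent a, h.time, move c a h.last) ∈ A then
          (δ.dist h c).elim 0 (fun p => p a) else 0 := by
      funext h
      obtain ⟨p, hp⟩ := Option.ne_none_iff_exists'.1 fun h0 => hc ((δ.eq_none_iff h c).1 h0)
      simp only [transLaw, hp, Option.elim]
      rw [Measure.map_apply Measurable.of_discrete hA, PMF.toMeasure_apply_fintype]
      · refine Finset.sum_congr rfl fun a _ => ?_
        simp [Set.indicator]
    rw [this]
    refine Finset.measurable_sum _ fun a _ => ?_
    refine Measurable.ite ?_ (δ.measurable c a) measurable_const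
    exact (measurable_const.prodMk (measurable_time.prodMk
      ((Measurable.of_discrete (f := fun s => move c a s)).comp measurable_last))) hA

/-- The law of the next transition, as a kernel. -/
noncomputable def transKernel (δ : G.Scheduler) : Kernel (G.Hist × G.GChoice) G.Obs :=
  ⟨fun q => transLaw δ q.1 q.2, measurable_transLaw δ⟩

instance (δ : G.Scheduler) : IsMarkovKernel (transKernel δ) :=
  ⟨fun q => inferInstanceAs (IsProbabilityMeasure (transLaw δ q.1 q.2))⟩

/-- The law of the next global choice, as a kernel. -/
noncomputable def choiceKernel (σ : ∀ j, G.Strategy j) :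
    Kernel (G.Hist × G.GChoice) G.GChoice :=
  ⟨fun q => choiceLaw σ q.1 q.2, measurable_choiceLaw σ⟩

instance (σ : ∀ j, G.Strategy j) : IsMarkovKernel (choiceKernel σ) :=
  ⟨fun q => inferInstanceAs (IsProbabilityMeasure (choiceLaw σ q.1 q.2))⟩

variable (G) in
/-- The part `→[aᵢ, tᵢ] sᵢ cᵢ` of a play. -/
abbrev Stage : Type (max u v) := G.Obs × G.GChoice

/-- From a history and the current choice to the next transition and the next choice. -/
noncomputable def stepKernel (σ : ∀ j, G.Strategy j) (δ : G.Scheduler) :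
    Kernel (G.Hist × G.GChoice) G.Stage :=
  transKernel δ ⊗ₖ (choiceKernel σ).comap
    (fun q : (G.Hist × G.GChoice) × G.Obs => (q.1.1.extend q.1.2 q.2, q.1.2))
    (measurable_extend.prodMk (by fun_prop))

instance (σ : ∀ j, G.Strategy j) (δ : G.Scheduler) : IsMarkovKernel (stepKernel σ δ) := by
  unfold stepKernel
  infer_instance

/-- The history and the current choice given by the stages `0, …, i`. -/
def toHist (i : ℕ) (p : Finset.Iic i → G.Stage) : G.Hist × G.GChoice :=
  (((p ⟨0, by simp⟩).1.2.2, List.ofFn fun m : Fin i =>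
      ((p ⟨m, by simp [m.2.le]⟩).2, (p ⟨m + 1, by simp⟩).1)),
    (p ⟨i, by simp⟩).2)

theorem measurable_toHist (i : ℕ) :
    Measurable (toHist i : (Finset.Iic i → G.Stage) → G.Hist × G.GChoice) := by
  refine Measurable.prodMk (Measurable.prodMk (by fun_prop) ?_) (by fun_prop)
  refine (measurable_ofFn (X := G.HStep) i).comp (measurable_pi_iff.2 fun m => ?_)
  fun_prop

/-- The law of stage `0`: the play starts in the initial state and all players choose. -/
noncomputable def initLaw (σ : ∀ j, G.Strategy j) : Measure G.Stage :=
  (Measure.dirac (G.noEvent, 0, G.gInit)).prod (choiceLaw σ (G.gInit, []) default)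

instance (σ : ∀ j, G.Strategy j) : IsProbabilityMeasure (initLaw σ) := by
  unfold initLaw
  infer_instance

/-- The law of the play under the strategy profile `σ` and the scheduler `δ`. -/
noncomputable def playLaw (σ : ∀ j, G.Strategy j) (δ : G.Scheduler) : Measure (ℕ → G.Stage) :=
  Kernel.trajMeasure (X := fun _ => G.Stage) (initLaw σ)
    fun i => (stepKernel σ δ).comap (toHist i) (measurable_toHist i)

variable (G) in
/-- The plays: the sequences `s₀ c₀ →[a₁, t₁] s₁ c₁ →[a₂, t₂] ⋯` that start in the initial state
and follow the rules. A play that reaches a stage without enabled actions and without delay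
transitions stops there, that is, repeats that stage with `noEvent` as label. -/
def plays : Set (ℕ → G.Stage) :=
  {ρ | (ρ 0).1 = (G.noEvent, 0, G.gInit) ∧
    (∀ m j, ((ρ m).2 j).Available ((ρ m).1.2.2 j)) ∧
    (∀ m j, j ∉ sync (ρ (m + 1)).1.1 → (ρ (m + 1)).2 j = (ρ m).2 j) ∧
    ∀ m,
      (∃ a ∈ enabled (ρ m).2,
        (ρ (m + 1)).1 = (actionEvent a, (ρ m).1.2.1, move (ρ m).2 a (ρ m).1.2.2)) ∨
      (enabled (ρ m).2 = ∅ ∧ ∃ e : G.DelayTrans (ρ m).1.2.2, ∃ d : ℝ, 0 ≤ d ∧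
        (ρ (m + 1)).1 = (G.delayEvent e.1, (ρ m).1.2.1 + d,
          Function.update (ρ m).1.2.2 e.1 e.2.1.2)) ∨
      (enabled (ρ m).2 = ∅ ∧ IsEmpty (G.DelayTrans (ρ m).1.2.2) ∧
        (ρ (m + 1)).1 = (G.noEvent, (ρ m).1.2))}

/-- Stage `m` is visible for player `j`: the start, or a transition that `j` takes part in. -/
def Visible (j : Fin n) (ρ : ℕ → G.Stage) (m : ℕ) : Prop := m = 0 ∨ j ∈ sync (ρ m).1.1

open Classical in
/-- The local play of player `j`, a finite or infinite sequence: its `k`-th entry is the label, the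
time, the local state and the local choice at the `k`-th stage visible for `j`, and `none` if there
are at most `k` such stages (counting from `0`). -/
noncomputable def localPlay (j : Fin n) (ρ : ℕ → G.Stage) (k : ℕ) :
    Option (G.Event × ℝ × (G.comp j).State × (G.comp j).Choice) :=
  if (k : ℕ∞) < {m | Visible j ρ m}.encard then
    let m := Nat.nth (Visible j ρ) k
    some ((ρ m).1.1, (ρ m).1.2.1, (ρ m).1.2.2 j, (ρ m).2 j)
  else none

/-- Local observation equivalence. -/
def LocallyEquivalent (ρ ρ' : ℕ → G.Stage) : Prop := ∀ j, localPlay j ρ = localPlay j ρ'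

end DistributedIMC

/-!
The probability of an event that is closed under local observation equivalence does not depend on
the scheduler, for two reasons. First, the interleaving of actions does not matter in distribution:
different enabled actions involve disjoint sets of players, so they commute, and the new choices are
drawn independently according to local histories (`actVal_comm`). Second, a scheduler cannot prevent
an enabled action from being taken: since each action is shared by a player without a cycle through
it, sequences of actions terminate (`wellFounded_gStep`).

To exploit this for reachability, consider a *target*: a set of histories with current choices that
is closed under continuation and invariant under what the players do not observe. Let `infVal` be
the one-step expectation under a scheduler that minimizes it. Its iterates, applied to the
indicator function of a target, increase to a function `reachVal` with `infVal reachVal = reachVal`.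
By induction along the terminating sequences of actions, commutation implies that in such a fixed
point the minimum is attained by every enabled action (`actVal_eq_of_infVal_eq`). Hence `reachVal`
is also a fixed point of the one-step expectation under an arbitrary scheduler, so that it is an
upper bound for the probability of reaching the target; it is a lower bound by its definition
(`IsTarget.playLaw_reach`).

Reachability events of targets are closed under intersection, so the laws of the play under two
schedulers agree on the `σ`-algebra that they generate. Countably many of these events determine the
local plays (`locallyEquivalent_of_reach`). By Blackwell's theorem on countably generated
sub-`σ`-algebras of standard Borel spaces, every measurable set of plays that is closed under local
observation equivalence therefore belongs to that `σ`-algebra, up to the null set of sequences that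
are not plays (`exists_measurableSet_reach`, `ae_mem_plays`).
-/

namespace DistributedIMC

open scoped ENNReal

variable {n : ℕ} {α : Type v} {G : DistributedIMC.{u, v} n α}

/-! ### Histories up to local observation -/

theorem Hist.last_extend (h : G.Hist) (c : G.GChoice) (o : G.Obs) :
    (h.extend c o).last = o.2.2 := by
  simp [Hist.last, Hist.extend]

theorem Hist.time_extend (h : G.Hist) (c : G.GChoice) (o : G.Obs) :
    (h.extend c o).time = o.2.1 := by
  simp [Hist.time, Hist.extend]

theorem Hist.active_extend (h : G.Hist) (c : G.GChoice) (o : G.Obs) :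
    (h.extend c o).active = sync o.1 := by
  simp [Hist.active, Hist.extend]

theorem Hist.local_extend_of_mem (h : G.Hist) (c : G.GChoice) (o : G.Obs) {j : Fin n}
    (hj : j ∈ sync o.1) : (h.extend c o).local j =
      ((h.local j).1, (h.local j).2 ++ [(c j, o.1, o.2.1, o.2.2 j)]) := by
  simp [Hist.local, Hist.extend, List.filterMap_append, hj]

theorem Hist.local_extend_of_notMem (h : G.Hist) (c : G.GChoice) (o : G.Obs) {j : Fin n}
    (hj : j ∉ sync o.1) : (h.extend c o).local j = h.local j := by
  simp [Hist.local, Hist.extend, List.filterMap_append, hj]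

/-- Two histories that no player can tell apart. The last state and the time are listed
separately, because a history that does not follow the rules may not be consistent with them. -/
structure Indist (h h' : G.Hist) : Prop where
  last : h.last = h'.last
  time : h.time = h'.time
  locals : ∀ j, h.local j = h'.local j

theorem Indist.extend {h h' : G.Hist} (hh : Indist h h') (c : G.GChoice) (o : G.Obs) :
    Indist (h.extend c o) (h'.extend c o) where
  last := by simp only [Hist.last_extend]
  time := by simp only [Hist.time_extend]
  locals j := by
    by_cases hj : j ∈ sync o.1
    · simp only [Hist.local_extend_of_mem _ _ _ hj, hh.locals]
    · simp only [Hist.local_extend_of_notMem _ _ _ hj, hh.locals]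

/-- The function of a history and a choice depends on the history only through what the players
observe. -/
def Invariant {Y : Type*} (g : G.Hist × G.GChoice → Y) : Prop :=
  ∀ ⦃h h'⦄ (c : G.GChoice), Indist h h' → g (h, c) = g (h', c)

theorem choiceLaw_congr (σ : ∀ j, G.Strategy j) {h h' : G.Hist} (c : G.GChoice)
    (hact : h.active = h'.active) (hloc : ∀ j, h.local j = h'.local j) :
    choiceLaw σ h c = choiceLaw σ h' c := by
  unfold choiceLaw
  rw [hact]
  simp only [hloc]

/-! ### One-step expectations -/

/-- The expectation of `g` after the transition `o`, over the new choices of the players that take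
part in it. -/
noncomputable def afterObs (σ : ∀ j, G.Strategy j) (g : G.Hist × G.GChoice → ℝ≥0∞)
    (q : G.Hist × G.GChoice) (o : G.Obs) : ℝ≥0∞ :=
  ∫⁻ c', g (q.1.extend q.2 o, c') ∂choiceLaw σ (q.1.extend q.2 o) q.2

/-- The transition by the action `a`. -/
noncomputable def actObs (q : G.Hist × G.GChoice) (a : G.Action) : G.Obs :=
  (actionEvent a, q.1.time, move q.2 a q.1.last)

/-- The expectation of `g` after the action `a`. -/
noncomputable def actVal (σ : ∀ j, G.Strategy j) (a : G.Action) (g : G.Hist × G.GChoice → ℝ≥0∞)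
    (q : G.Hist × G.GChoice) : ℝ≥0∞ :=
  afterObs σ g q (actObs q a)

open Classical in
/-- The law of the next transition in state `s` at time `t` when no action is enabled: a race of
exponential delays, or the stopping of the play. -/
noncomputable def raceLaw (s : G.GState) (t : ℝ) : Measure G.Obs :=
  if _h : Nonempty (G.DelayTrans s) then
    (Measure.pi fun e : G.DelayTrans s => expMeasure (e.2.1.1 : ℝ)).map (delayObs s t)
  else Measure.dirac (G.noEvent, t, s)

/-- The expectation of `g` after one step under the scheduler `δ`. -/
noncomputable def stepVal (σ : ∀ j, G.Strategy j) (δ : G.Scheduler)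
    (g : G.Hist × G.GChoice → ℝ≥0∞) (q : G.Hist × G.GChoice) : ℝ≥0∞ :=
  ∫⁻ o, afterObs σ g q o ∂transLaw δ q.1 q.2

open Classical in
/-- The infimum over all schedulers of the expectation of `g` after one step: if some action is
enabled, the least expectation over the enabled actions. -/
noncomputable def infVal (σ : ∀ j, G.Strategy j) (g : G.Hist × G.GChoice → ℝ≥0∞)
    (q : G.Hist × G.GChoice) : ℝ≥0∞ :=
  if enabled q.2 = ∅ then ∫⁻ o, afterObs σ g q o ∂raceLaw q.1.last q.1.time
  else ⨅ a : enabled q.2, actVal σ a g q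

theorem transLaw_eq_raceLaw (δ : G.Scheduler) (h : G.Hist) {c : G.GChoice} (hc : enabled c = ∅) :
    transLaw δ h c = raceLaw h.last h.time := by
  simp only [transLaw, (δ.eq_none_iff h c).2 hc]
  rfl

theorem infVal_of_enabled_eq_empty (σ : ∀ j, G.Strategy j) (δ : G.Scheduler)
    (g : G.Hist × G.GChoice → ℝ≥0∞) {q : G.Hist × G.GChoice} (hq : enabled q.2 = ∅) :
    infVal σ g q = stepVal σ δ g q := by
  simp only [infVal, hq, if_true, stepVal, transLaw_eq_raceLaw δ q.1 hq]

theorem ae_mem_support {X : Type*} [MeasurableSpace X] [DiscreteMeasurableSpace X] (p : PMF X) :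
    ∀ᵐ x ∂p.toMeasure, x ∈ p.support := by
  rw [ae_iff, PMF.toMeasure_apply_eq_zero_iff _ (MeasurableSet.of_discrete)]
  exact Set.disjoint_left.2 fun x hx hx' => hx' hx

/-- If an action is enabled, a step is a mixture of the enabled actions. -/
theorem exists_stepVal_eq (σ : ∀ j, G.Strategy j) (δ : G.Scheduler) {q : G.Hist × G.GChoice}
    (hq : enabled q.2 ≠ ∅) : ∃ p : PMF G.Action, (∀ᵐ a ∂p.toMeasure, a ∈ enabled q.2) ∧
      ∀ g, Measurable (afterObs σ g q) →
        stepVal σ δ g q = ∫⁻ a, actVal σ a g q ∂p.toMeasure := by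
  obtain ⟨p, hp⟩ := Option.ne_none_iff_exists'.1 fun h0 => hq ((δ.eq_none_iff q.1 q.2).1 h0)
  refine ⟨p, (ae_mem_support p).mono fun a ha => δ.mem_enabled _ _ p hp a ha, fun g hg => ?_⟩
  simp only [stepVal, transLaw, hp]
  rw [lintegral_map hg Measurable.of_discrete]
  rfl

theorem infVal_le_actVal (σ : ∀ j, G.Strategy j) (g : G.Hist × G.GChoice → ℝ≥0∞)
    {q : G.Hist × G.GChoice} {a : G.Action} (ha : a ∈ enabled q.2) :
    infVal σ g q ≤ actVal σ a g q := by
  rw [infVal, if_neg (Set.nonempty_iff_ne_empty.1 ⟨a, ha⟩)]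
  exact iInf_le (fun a : enabled q.2 => actVal σ a g q) ⟨a, ha⟩

section Measurability

variable (σ : ∀ j, G.Strategy j) {g : G.Hist × G.GChoice → ℝ≥0∞}

theorem measurable_afterObs (hg : Measurable g) :
    Measurable fun p : (G.Hist × G.GChoice) × G.Obs => afterObs σ g p.1 p.2 := by
  have hk : Measurable fun p : (G.Hist × G.GChoice) × G.Obs => (p.1.1.extend p.1.2 p.2, p.1.2) :=
    measurable_extend.prodMk (by fun_prop)
  have hf : Measurable fun r : ((G.Hist × G.GChoice) × G.Obs) × G.GChoice =>
      g (r.1.1.1.extend r.1.1.2 r.1.2, r.2) :=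
    hg.comp ((measurable_extend.comp measurable_fst).prodMk measurable_snd)
  exact hf.lintegral_kernel_prod_right' (κ := (choiceKernel σ).comap _ hk)

theorem measurable_actObs (a : G.Action) :
    Measurable fun q : G.Hist × G.GChoice => actObs q a := by
  refine measurable_const.prodMk ((measurable_time.comp measurable_fst).prodMk ?_)
  exact (Measurable.of_discrete (f := fun r : G.GState × G.GChoice => move r.2 a r.1)).comp
    ((measurable_last.comp measurable_fst).prodMk measurable_snd)

theorem measurable_actVal (a : G.Action) (hg : Measurable g) : Measurable (actVal σ a g) :=
  (measurable_afterObs σ hg).comp (measurable_id.prodMk (measurable_actObs a))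

theorem measurable_stepVal (δ : G.Scheduler) (hg : Measurable g) :
    Measurable (stepVal σ δ g) :=
  (measurable_afterObs σ hg).lintegral_kernel_prod_right' (κ := transKernel δ)

theorem measurable_infVal (δ : G.Scheduler) (hg : Measurable g) : Measurable (infVal σ g) := by
  refine measurable_from_prod_countable_left fun c => ?_
  by_cases hc : enabled c = ∅
  · have : (fun h : G.Hist => infVal σ g (h, c)) = fun h => stepVal σ δ g (h, c) := by
      funext h
      exact infVal_of_enabled_eq_empty σ δ g hc
    rw [this]
    exact (measurable_stepVal σ δ hg).comp measurable_prodMk_right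
  · simp only [infVal, hc, if_false]
    exact Measurable.iInf fun a => (measurable_actVal σ a.1 hg).comp measurable_prodMk_right

end Measurability

/-! ### Invariance, monotonicity and continuity of the one-step expectations -/

section Operators

variable (σ : ∀ j, G.Strategy j) {g g' : G.Hist × G.GChoice → ℝ≥0∞}

theorem Invariant.afterObs (hg : Invariant g) (o : G.Obs) :
    Invariant fun q => afterObs σ g q o := by
  intro h h' c hh
  have hx := hh.extend c o
  simp only [DistributedIMC.afterObs]
  rw [choiceLaw_congr σ c (by simp only [Hist.active_extend]) hx.locals]
  exact lintegral_congr fun c' => hg c' hx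

theorem Invariant.actVal (hg : Invariant g) (a : G.Action) : Invariant (actVal σ a g) := by
  intro h h' c hh
  have : actObs (h, c) a = actObs (h', c) a := by simp only [actObs, hh.last, hh.time]
  rw [DistributedIMC.actVal, DistributedIMC.actVal, this]
  exact hg.afterObs σ _ c hh

theorem Invariant.infVal (hg : Invariant g) : Invariant (infVal σ g) := by
  intro h h' c hh
  simp only [DistributedIMC.infVal, hh.last, hh.time, hg.actVal σ _ c hh]
  congr 1
  exact lintegral_congr fun o => hg.afterObs σ o c hh

theorem afterObs_mono (h : g ≤ g') (q : G.Hist × G.GChoice) : afterObs σ g q ≤ afterObs σ g' q :=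
  fun _ => lintegral_mono fun _ => h _

theorem infVal_mono : Monotone (infVal σ) := by
  intro g g' h q
  unfold infVal
  split_ifs
  · exact lintegral_mono (afterObs_mono σ h q)
  · exact iInf_mono fun a => afterObs_mono σ h q _

theorem infVal_le_stepVal (δ : G.Scheduler) (hg : Measurable g) : infVal σ g ≤ stepVal σ δ g := by
  intro q
  by_cases hq : enabled q.2 = ∅
  · exact (infVal_of_enabled_eq_empty σ δ g hq).le
  · obtain ⟨p, hp, hstep⟩ := exists_stepVal_eq σ δ hq
    rw [hstep g ((measurable_afterObs σ hg).comp measurable_prodMk_left)]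
    calc infVal σ g q = ∫⁻ _, infVal σ g q ∂p.toMeasure := by simp
      _ ≤ _ := lintegral_mono_ae (hp.mono fun a ha => infVal_le_actVal σ g ha)

theorem afterObs_iSup {f : ℕ → G.Hist × G.GChoice → ℝ≥0∞} (hf : Monotone f)
    (q : G.Hist × G.GChoice) (o : G.Obs) :
    afterObs σ (⨆ N, f N) q o = ⨆ N, afterObs σ (f N) q o := by
  simp only [afterObs, iSup_apply]
  exact lintegral_iSup (fun _ => Measurable.of_discrete) fun i k hik c' => hf hik _

/-- As there are finitely many actions, the infimum over them commutes with increasing limits. -/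
theorem infVal_iSup (δ : G.Scheduler) {f : ℕ → G.Hist × G.GChoice → ℝ≥0∞} (hf : Monotone f)
    (hm : ∀ N, Measurable (f N)) : infVal σ (⨆ N, f N) = ⨆ N, infVal σ (f N) := by
  funext q
  rw [iSup_apply]
  by_cases hq : enabled q.2 = ∅
  · simp only [infVal_of_enabled_eq_empty σ δ _ hq, stepVal, afterObs_iSup σ hf]
    exact lintegral_iSup (fun N => (measurable_afterObs σ (hm N)).comp measurable_prodMk_left)
      fun i k hik => afterObs_mono σ (hf hik) q
  · simp only [infVal, hq, if_false, actVal, afterObs_iSup σ hf]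
    refine (iSup_iInf_of_monotone (f := fun (a : enabled q.2) N =>
      afterObs σ (f N) q (actObs q a.1)) fun a i k hik => ?_).symm
    exact afterObs_mono σ (hf hik) q _

end Operators

/-! ### Enabled actions commute -/

theorem sync_actObs (q : G.Hist × G.GChoice) (a : G.Action) :
    sync (actObs q a).1 = sync (actionEvent a) := rfl

/-- A player has chosen at most one action, so that different enabled actions involve different
players. -/
theorem disjoint_sync {c : G.GChoice} {a b : G.Action} (ha : a ∈ enabled c) (hb : b ∈ enabled c)
    (hab : a ≠ b) : Disjoint (sync (actionEvent a)) (sync (actionEvent b)) := by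
  refine Set.disjoint_left.2 fun j hja hjb => hab ?_
  have h1 := ha j hja
  have h2 := hb j hjb
  cases hc : c j with
  | none => simp [IMC.Choice.HasAction, hc] at h1
  | some x =>
    simp only [IMC.Choice.HasAction, hc] at h1 h2
    exact Subtype.ext (h1.symm.trans h2)

theorem mem_enabled_congr {c c' : G.GChoice} {a : G.Action} (ha : a ∈ enabled c)
    (h : ∀ j ∈ sync (actionEvent a), c' j = c j) : a ∈ enabled c' :=
  fun j hj => by rw [h j hj]; exact ha j hj

open Classical in
/-- New choices can be drawn for all players, and then be used for the active ones only. For the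
inactive players the law that is drawn from is arbitrary. -/
theorem lintegral_choiceLaw (σ : ∀ j, G.Strategy j) (h : G.Hist) (c : G.GChoice)
    {A : Set (Fin n)} (hA : h.active = A) (μ : ∀ j, PMF (G.comp j).Choice)
    (hμ : ∀ j ∈ A, μ j = (σ j).dist (h.local j)) (F : G.GChoice → ℝ≥0∞) :
    ∫⁻ c', F c' ∂choiceLaw σ h c =
      ∫⁻ w, F (A.piecewise w c) ∂Measure.pi fun j => (μ j).toMeasure := by
  subst hA
  have key : choiceLaw σ h c = (Measure.pi fun j => (μ j).toMeasure).map
      fun w j => if j ∈ h.active then w j else c j := by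
    have hs : ∀ j, IsProbabilityMeasure
        ((μ j).toMeasure.map fun w => if j ∈ h.active then w else c j) :=
      fun j => Measure.isProbabilityMeasure_map Measurable.of_discrete.aemeasurable
    rw [Measure.pi_map_pi (f := fun j w => if j ∈ h.active then w else c j)
      fun j => Measurable.of_discrete.aemeasurable]
    unfold choiceLaw
    congr 1
    funext j
    by_cases hj : j ∈ h.active
    · simp [hj, hμ j hj]
    · simp only [hj, if_false]
      rw [Measure.map_const]
      simp
  rw [key, lintegral_map Measurable.of_discrete Measurable.of_discrete]
  rfl

open Classical in
/-- The choices for both of two successive actions with disjoint sets of players can be drawn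
beforehand, from laws that do not depend on the order of the actions. -/
theorem actVal_actVal_eq (σ : ∀ j, G.Strategy j) (g : G.Hist × G.GChoice → ℝ≥0∞) {h : G.Hist}
    {c : G.GChoice} {a b : G.Action}
    (hab : Disjoint (sync (actionEvent a)) (sync (actionEvent b))) :
    actVal σ a (actVal σ b g) (h, c) =
      ∫⁻ w, ∫⁻ w',
        g ((h.extend c (actObs (h, c) a)).extend ((sync (actionEvent a)).piecewise w c)
            (actObs (h.extend c (actObs (h, c) a), (sync (actionEvent a)).piecewise w c) b),
          (sync (actionEvent b)).piecewise w' ((sync (actionEvent a)).piecewise w c))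
        ∂(Measure.pi fun j => ((σ j).dist ((h.extend c (actObs (h, c) b)).local j)).toMeasure)
        ∂(Measure.pi fun j => ((σ j).dist ((h.extend c (actObs (h, c) a)).local j)).toMeasure) := by
  rw [actVal, afterObs, lintegral_choiceLaw σ _ _ (A := sync (actionEvent a))
    (Hist.active_extend _ _ _)
    (fun j => (σ j).dist ((h.extend c (actObs (h, c) a)).local j)) fun j _ => rfl]
  refine lintegral_congr fun w => ?_
  rw [actVal, afterObs, lintegral_choiceLaw σ _ _ (A := sync (actionEvent b))
    (Hist.active_extend _ _ _)
    (fun j => (σ j).dist ((h.extend c (actObs (h, c) b)).local j)) fun j hj => ?_]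
  have hja : j ∉ sync (actionEvent a) := Set.disjoint_right.1 hab hj
  rw [Hist.local_extend_of_mem _ _ _ hj, Hist.local_extend_of_mem _ _ _ (by exact hj),
    Hist.local_extend_of_notMem _ _ _ (by exact hja)]
  simp [actObs, Hist.time_extend, Hist.last_extend, move, hj, hja]

open Classical in
/-- No player can tell in which order two actions with disjoint sets of players were taken. -/
theorem indist_swap (h : G.Hist) (c : G.GChoice) {a b : G.Action}
    (hab : Disjoint (sync (actionEvent a)) (sync (actionEvent b))) (w w' : G.GChoice) :
    Indist
      ((h.extend c (actObs (h, c) a)).extend ((sync (actionEvent a)).piecewise w c)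
        (actObs (h.extend c (actObs (h, c) a), (sync (actionEvent a)).piecewise w c) b))
      ((h.extend c (actObs (h, c) b)).extend ((sync (actionEvent b)).piecewise w' c)
        (actObs (h.extend c (actObs (h, c) b), (sync (actionEvent b)).piecewise w' c) a)) where
  last := by
    funext j
    by_cases hja : j ∈ sync (actionEvent a)
    · have hjb := Set.disjoint_left.1 hab hja
      simp [Hist.last_extend, actObs, move, hja, hjb]
    · by_cases hjb : j ∈ sync (actionEvent b) <;>
        simp [Hist.last_extend, actObs, move, hja, hjb]
  time := by simp only [Hist.time_extend, actObs]
  locals j := by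
    by_cases hja : j ∈ sync (actionEvent a)
    · have hjb := Set.disjoint_left.1 hab hja
      rw [Hist.local_extend_of_notMem _ _ _ (by exact hjb), Hist.local_extend_of_mem _ _ _ hja,
        Hist.local_extend_of_mem _ _ _ (by exact hja), Hist.local_extend_of_notMem _ _ _ hjb]
      simp [actObs, Hist.time_extend, Hist.last_extend, move, hja, hjb]
    · by_cases hjb : j ∈ sync (actionEvent b)
      · rw [Hist.local_extend_of_mem _ _ _ (by exact hjb), Hist.local_extend_of_notMem _ _ _ hja,
          Hist.local_extend_of_notMem _ _ _ (by exact hja), Hist.local_extend_of_mem _ _ _ hjb]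
        simp [actObs, Hist.time_extend, Hist.last_extend, move, hja, hjb]
      · rw [Hist.local_extend_of_notMem _ _ _ (by exact hjb), Hist.local_extend_of_notMem _ _ _ hja,
          Hist.local_extend_of_notMem _ _ _ (by exact hja), Hist.local_extend_of_notMem _ _ _ hjb]

theorem actVal_comm (σ : ∀ j, G.Strategy j) {g : G.Hist × G.GChoice → ℝ≥0∞} (hg : Invariant g)
    (h : G.Hist) {c : G.GChoice} {a b : G.Action} (ha : a ∈ enabled c) (hb : b ∈ enabled c)
    (hab : a ≠ b) : actVal σ a (actVal σ b g) (h, c) = actVal σ b (actVal σ a g) (h, c) := by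
  classical
  have hdisj := disjoint_sync ha hb hab
  rw [actVal_actVal_eq σ g hdisj, actVal_actVal_eq σ g hdisj.symm,
    lintegral_lintegral_swap Measurable.of_discrete.aemeasurable]
  refine lintegral_congr fun w' => lintegral_congr fun w => ?_
  rw [hg _ (indist_swap h c hdisj w w')]
  congr 2
  funext j
  by_cases hja : j ∈ sync (actionEvent a)
  · simp [hja, Set.disjoint_left.1 hdisj hja]
  · by_cases hjb : j ∈ sync (actionEvent b) <;> simp [hja, hjb]

/-! ### Admissible choices -/

/-- The choices are available in the current state. -/
def Valid (q : G.Hist × G.GChoice) : Prop := ∀ j, (q.2 j).Available (q.1.last j)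

open Classical in
theorem ae_choiceLaw_of_ae (σ : ∀ j, G.Strategy j) (h : G.Hist) (c : G.GChoice) {j : Fin n}
    {p : (G.comp j).Choice → Prop}
    (hp : ∀ᵐ x ∂(if j ∈ h.active then ((σ j).dist (h.local j)).toMeasure
      else Measure.dirac (c j)), p x) :
    ∀ᵐ c' ∂choiceLaw σ h c, p (c' j) := by
  have (i : Fin n) : IsProbabilityMeasure
      (if i ∈ h.active then ((σ i).dist (h.local i)).toMeasure else Measure.dirac (c i)) := by
    split_ifs <;> infer_instance
  exact (Measure.tendsto_eval_ae_ae (μ := fun i =>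
    if i ∈ h.active then ((σ i).dist (h.local i)).toMeasure else Measure.dirac (c i))
    (i := j)).eventually hp

theorem ae_choiceLaw_eq (σ : ∀ j, G.Strategy j) (h : G.Hist) (c : G.GChoice) :
    ∀ᵐ c' ∂choiceLaw σ h c, ∀ j, j ∉ h.active → c' j = c j := by
  classical
  refine ae_all_iff.2 fun j => ae_choiceLaw_of_ae σ h c (p := fun x => j ∉ h.active → x = c j) ?_
  by_cases hj : j ∈ h.active
  · simp [hj]
  · simp only [hj, if_false, not_false_eq_true, true_imp_iff]
    exact (ae_dirac_iff MeasurableSet.of_discrete).2 rfl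

theorem ae_choiceLaw_available (σ : ∀ j, G.Strategy j) (h : G.Hist) (c : G.GChoice) :
    ∀ᵐ c' ∂choiceLaw σ h c, ∀ j, j ∈ h.active → (c' j).Available (h.local j).last := by
  classical
  refine ae_all_iff.2 fun j => ae_choiceLaw_of_ae σ h c
    (p := fun x : (G.comp j).Choice => j ∈ h.active → x.Available (h.local j).last) ?_
  by_cases hj : j ∈ h.active
  · simp only [hj, if_true, true_imp_iff]
    exact (ae_mem_support _).mono fun x hx => (σ j).available _ x hx
  · simp [hj]

/-- Choices stay available if the transition does not change the states of the other players. -/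
theorem ae_valid_extend (σ : ∀ j, G.Strategy j) {h : G.Hist} {c : G.GChoice} {o : G.Obs}
    (hv : Valid (h, c)) (ho : ∀ j ∉ sync o.1, o.2.2 j = h.last j) :
    ∀ᵐ c' ∂choiceLaw σ (h.extend c o) c, Valid (h.extend c o, c') := by
  filter_upwards [ae_choiceLaw_eq σ (h.extend c o) c, ae_choiceLaw_available σ (h.extend c o) c]
    with c' h1 h2 j
  rw [Hist.active_extend] at h1 h2
  simp only [Hist.last_extend]
  by_cases hj : j ∈ sync o.1
  · have := h2 j hj
    rw [Hist.local_extend_of_mem _ _ _ hj] at this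
    simpa [LocalHist.last] using this
  · rw [h1 j hj, ho j hj]
    exact hv j

theorem actObs_state_of_notMem (q : G.Hist × G.GChoice) (a : G.Action) :
    ∀ j ∉ sync (actObs q a).1, (actObs q a).2.2 j = q.1.last j := by
  intro j hj
  rw [sync_actObs] at hj
  simp [actObs, move, hj]

/-! ### Sequences of actions terminate -/

variable (G) in
/-- Some action leads from the global state `s` to `s'`. -/
def GStep (s s' : G.GState) : Prop :=
  ∃ a : G.Action, (∀ j ∈ sync (actionEvent a), (s j, a.1, s' j) ∈ (G.comp j).trans) ∧
    ∀ j ∉ sync (actionEvent a), s' j = s j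

theorem GStep.reflTransGen_step {s s' : G.GState} (h : Relation.ReflTransGen G.GStep s s')
    (j : Fin n) : Relation.ReflTransGen (G.comp j).Step (s j) (s' j) := by
  induction h with
  | refl => exact .refl
  | tail _ h ih =>
    obtain ⟨a, h1, h2⟩ := h
    by_cases hj : j ∈ sync (actionEvent a)
    · exact ih.tail ⟨a.1, h1 j hj⟩
    · rwa [h2 j hj]

/-- A cycle of actions would project to a cycle through the same action in each of the modules
that share it. -/
theorem wellFounded_gStep (hG : G.NoActionCycles) : WellFounded fun s' s => G.GStep s s' := by
  let r : G.GState → G.GState → Prop := fun s' s => Relation.TransGen G.GStep s s'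
  have : IsTrans G.GState r := ⟨fun _ _ _ h1 h2 => h2.trans h1⟩
  have : Std.Irrefl r := by
    refine ⟨fun s hs => ?_⟩
    obtain ⟨s', ⟨a, h1, -⟩, h2⟩ := Relation.TransGen.head'_iff.1 hs
    obtain ⟨j, hj, hcycle⟩ := hG a
    exact hcycle ⟨s j, s' j, h1 j hj, GStep.reflTransGen_step h2 j⟩
  exact Subrelation.wf (fun h => Relation.TransGen.single h)
    (Finite.wellFounded_of_trans_of_irrefl r)

theorem gStep_move {h : G.Hist} {c : G.GChoice} (hv : Valid (h, c)) {a : G.Action}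
    (ha : a ∈ enabled c) : G.GStep h.last (move c a h.last) := by
  refine ⟨a, fun j hj => ?_, fun j hj => by simp [move, hj]⟩
  have h1 := ha j hj
  have h2 := hv j
  cases hc : c j with
  | none => simp [IMC.Choice.HasAction, hc] at h1
  | some x =>
    simp only [IMC.Choice.HasAction, hc] at h1
    simp only [IMC.Choice.Available, hc] at h2
    have hx := x.2
    simp only [move, hj, if_true, hc, IMC.Choice.target]
    rw [← h1, ← h2]
    exact hx

/-! ### Harmonic functions of the infimum operator -/

/-- A fixed point of the infimum operator does not depend on which enabled action is taken: by
induction along the terminating sequences of actions, `b` can be taken right after `a`, and the two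
commute. -/
theorem actVal_eq_of_infVal_eq (hG : G.NoActionCycles) (σ : ∀ j, G.Strategy j)
    {g : G.Hist × G.GChoice → ℝ≥0∞} (hinv : Invariant g) (hfix : infVal σ g = g) {h : G.Hist}
    {c : G.GChoice} (hv : Valid (h, c)) {a : G.Action} (ha : a ∈ enabled c) :
    actVal σ a g (h, c) = g (h, c) := by
  suffices H : ∀ s : G.GState, ∀ (h : G.Hist) (c : G.GChoice), h.last = s → Valid (h, c) →
      ∀ a ∈ enabled c, actVal σ a g (h, c) = g (h, c) from H _ h c rfl hv a ha
  clear ha hv a c h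
  intro s
  induction s using (wellFounded_gStep hG).induction with
  | _ s ih =>
    intro h c hs hv a ha
    -- After `a` the action `b` is still enabled, and the induction hypothesis applies to it.
    have key : ∀ a ∈ enabled c, ∀ b ∈ enabled c, a ≠ b →
        actVal σ a g (h, c) = actVal σ a (actVal σ b g) (h, c) := by
      intro a ha b hb hab
      refine lintegral_congr_ae ?_
      filter_upwards [ae_valid_extend σ (o := actObs (h, c) a) hv (actObs_state_of_notMem _ a),
        ae_choiceLaw_eq σ (h.extend c (actObs (h, c) a)) c] with c' hv' hc'
      refine (ih (move c a s) (hs ▸ gStep_move hv ha) _ c' ?_ hv' b ?_).symm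
      · rw [Hist.last_extend, ← hs]
        rfl
      · refine mem_enabled_congr hb fun j hj => hc' j ?_
        rw [Hist.active_extend]
        exact Set.disjoint_right.1 (disjoint_sync ha hb hab) hj
    have heq : ∀ b ∈ enabled c, actVal σ b g (h, c) = actVal σ a g (h, c) := by
      intro b hb
      by_cases hab : a = b
      · rw [hab]
      · rw [key a ha b hb hab, key b hb a ha (Ne.symm hab), actVal_comm σ hinv h ha hb hab]
    have : Nonempty (enabled c) := ⟨⟨a, ha⟩⟩
    rw [← congrFun hfix (h, c), infVal, if_neg (Set.nonempty_iff_ne_empty.1 ⟨a, ha⟩)]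
    rw [iInf_congr fun b : enabled c => heq b.1 b.2, iInf_const]

theorem stepVal_eq_of_infVal_eq (hG : G.NoActionCycles) (σ : ∀ j, G.Strategy j) (δ : G.Scheduler)
    {g : G.Hist × G.GChoice → ℝ≥0∞} (hg : Measurable g) (hinv : Invariant g)
    (hfix : infVal σ g = g) {q : G.Hist × G.GChoice} (hv : Valid q) : stepVal σ δ g q = g q := by
  by_cases hq : enabled q.2 = ∅
  · rw [← infVal_of_enabled_eq_empty σ δ g hq, hfix]
  · obtain ⟨p, hp, hstep⟩ := exists_stepVal_eq σ δ hq
    rw [hstep g ((measurable_afterObs σ hg).comp measurable_prodMk_left),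
      lintegral_congr_ae (hp.mono fun a ha => actVal_eq_of_infVal_eq hG σ hinv hfix hv ha)]
    simp

/-! ### Reaching a set of histories -/

/-- A set of histories with current choices, closed under continuation. Such a set is reached if
some prefix of the play lies in it. -/
structure IsTarget (U : Set (G.Hist × G.GChoice)) : Prop where
  measurableSet : MeasurableSet U
  invariant : Invariant (· ∈ U)
  extend : ∀ h c o c', (h, c) ∈ U → (∀ j ∉ sync o.1, c' j = c j) → (Hist.extend h c o, c') ∈ U

/-- The indicator function of `U`. -/
noncomputable def ind (U : Set (G.Hist × G.GChoice)) : G.Hist × G.GChoice → ℝ≥0∞ :=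
  U.indicator 1

/-- The limit, as the horizon grows, of the infimum over all schedulers of the probability of
reaching `U` within the horizon. -/
noncomputable def reachVal (σ : ∀ j, G.Strategy j) (U : Set (G.Hist × G.GChoice)) :
    G.Hist × G.GChoice → ℝ≥0∞ :=
  ⨆ N, (infVal σ)^[N] (ind U)

section Reach

variable (σ : ∀ j, G.Strategy j) {U : Set (G.Hist × G.GChoice)}

theorem IsTarget.measurable_ind (hU : IsTarget U) : Measurable (ind U) :=
  measurable_one.indicator hU.measurableSet

theorem IsTarget.invariant_ind (hU : IsTarget U) : Invariant (ind U) := by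
  classical
  intro h h' c hh
  simp only [ind, Set.indicator_apply, hU.invariant c hh, Pi.one_apply]

theorem IsTarget.afterObs_ind (hU : IsTarget U) {q : G.Hist × G.GChoice} (hq : q ∈ U)
    (o : G.Obs) : afterObs σ (ind U) q o = 1 := by
  have : ∀ᵐ c' ∂choiceLaw σ (q.1.extend q.2 o) q.2, ind U (q.1.extend q.2 o, c') = 1 := by
    filter_upwards [ae_choiceLaw_eq σ (q.1.extend q.2 o) q.2] with c' hc'
    rw [Hist.active_extend] at hc'
    exact Set.indicator_of_mem (hU.extend _ _ o c' hq hc') 1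
  rw [afterObs, lintegral_congr_ae this]
  simp

theorem IsTarget.ind_le_infVal (hU : IsTarget U) (δ : G.Scheduler) :
    ind U ≤ infVal σ (ind U) := by
  intro q
  by_cases hq : q ∈ U
  · refine (Set.indicator_le_self' (by simp) q).trans ?_
    by_cases he : enabled q.2 = ∅
    · rw [infVal_of_enabled_eq_empty σ δ _ he]
      simp [stepVal, hU.afterObs_ind σ hq]
    · simp [infVal, he, actVal, hU.afterObs_ind σ hq]
  · simp [ind, hq]

theorem IsTarget.monotone_iterate (hU : IsTarget U) (δ : G.Scheduler) :
    Monotone fun N => (infVal σ)^[N] (ind U) :=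
  (infVal_mono σ).monotone_iterate_of_le_map (hU.ind_le_infVal σ δ)

theorem IsTarget.measurable_iterate (hU : IsTarget U) (δ : G.Scheduler) (N : ℕ) :
    Measurable ((infVal σ)^[N] (ind U)) := by
  induction N with
  | zero => exact hU.measurable_ind
  | succ N ih =>
    rw [Function.iterate_succ_apply']
    exact measurable_infVal σ δ ih

theorem IsTarget.measurable_reachVal (hU : IsTarget U) (δ : G.Scheduler) :
    Measurable (reachVal σ U) := by
  simpa only [reachVal, ← iSup_apply] using Measurable.iSup (hU.measurable_iterate σ δ)

theorem IsTarget.invariant_reachVal (hU : IsTarget U) : Invariant (reachVal σ U) := by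
  have (N : ℕ) : Invariant ((infVal σ)^[N] (ind U)) := by
    induction N with
    | zero => exact hU.invariant_ind
    | succ N ih =>
      rw [Function.iterate_succ_apply']
      exact ih.infVal σ
  intro h h' c hh
  simp only [reachVal, iSup_apply]
  exact iSup_congr fun N => this N c hh

theorem IsTarget.infVal_reachVal (hU : IsTarget U) (δ : G.Scheduler) :
    infVal σ (reachVal σ U) = reachVal σ U := by
  rw [reachVal, infVal_iSup σ δ (hU.monotone_iterate σ δ) (hU.measurable_iterate σ δ)]
  simp only [← Function.iterate_succ_apply' (infVal σ)]
  exact (hU.monotone_iterate σ δ).iSup_nat_add 1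

end Reach

/-! ### Prefixes of plays -/

/-- The history and the current choice after `N` steps. -/
def histAt (N : ℕ) (ρ : ℕ → G.Stage) : G.Hist × G.GChoice := toHist N (Preorder.frestrictLe N ρ)

theorem measurable_histAt (N : ℕ) : Measurable (histAt N : (ℕ → G.Stage) → G.Hist × G.GChoice) :=
  (measurable_toHist N).comp (Preorder.measurable_frestrictLe N)

theorem histAt_zero (ρ : ℕ → G.Stage) : histAt 0 ρ = (((ρ 0).1.2.2, []), (ρ 0).2) := by
  simp [histAt, toHist]

theorem histAt_choice (N : ℕ) (ρ : ℕ → G.Stage) : (histAt N ρ).2 = (ρ N).2 := rfl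

theorem histAt_succ (N : ℕ) (ρ : ℕ → G.Stage) : histAt (N + 1) ρ =
    ((histAt N ρ).1.extend (histAt N ρ).2 (ρ (N + 1)).1, (ρ (N + 1)).2) := by
  simp only [histAt, toHist, Hist.extend, List.ofFn_succ', List.concat_eq_append]
  rfl

theorem histAt_last (N : ℕ) (ρ : ℕ → G.Stage) : (histAt N ρ).1.last = (ρ N).1.2.2 := by
  cases N with
  | zero => simp [histAt_zero, Hist.last]
  | succ N => rw [histAt_succ, Hist.last_extend]

theorem histAt_time (N : ℕ) {ρ : ℕ → G.Stage} (h0 : (ρ 0).1.2.1 = 0) :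
    (histAt N ρ).1.time = (ρ N).1.2.1 := by
  cases N with
  | zero => simp [histAt_zero, Hist.time, h0]
  | succ N => rw [histAt_succ, Hist.time_extend]

instance (σ : ∀ j, G.Strategy j) (δ : G.Scheduler) : IsProbabilityMeasure (playLaw σ δ) := by
  unfold playLaw
  infer_instance

theorem lintegral_playLaw_succ (σ : ∀ j, G.Strategy j) (δ : G.Scheduler) (N : ℕ)
    {F : (G.Hist × G.GChoice) × G.Stage → ℝ≥0∞} (hF : Measurable F) :
    ∫⁻ ρ, F (histAt N ρ, ρ (N + 1)) ∂playLaw σ δ =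
      ∫⁻ ρ, ∫⁻ x, F (histAt N ρ, x) ∂stepKernel σ δ (histAt N ρ) ∂playLaw σ δ := by
  have hF' : Measurable fun r : (Finset.Iic N → G.Stage) × G.Stage => F (toHist N r.1, r.2) :=
    hF.comp (((measurable_toHist N).comp measurable_fst).prodMk measurable_snd)
  have h := Kernel.map_frestrictLe_trajMeasure_compProd_eq_map_trajMeasure
    (X := fun _ => G.Stage) (μ₀ := initLaw σ)
    (κ := fun i => (stepKernel σ δ).comap (toHist i) (measurable_toHist i)) (a := N)
  have h1 := congrArg (fun μ => ∫⁻ r, F (toHist N r.1, r.2) ∂μ) h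
  rw [Measure.lintegral_compProd hF', lintegral_map hF'.lintegral_kernel_prod_right'
    (Preorder.measurable_frestrictLe N), lintegral_map hF' (by fun_prop)] at h1
  exact h1.symm

theorem ae_playLaw_succ (σ : ∀ j, G.Strategy j) (δ : G.Scheduler) (N : ℕ)
    {p : (G.Hist × G.GChoice) × G.Stage → Prop} (hp : MeasurableSet {r | p r})
    (h : ∀ᵐ ρ ∂playLaw σ δ, ∀ᵐ x ∂stepKernel σ δ (histAt N ρ), p (histAt N ρ, x)) :
    ∀ᵐ ρ ∂playLaw σ δ, p (histAt N ρ, ρ (N + 1)) := by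
  classical
  have hF : Measurable ({r | p r}ᶜ.indicator (1 : (G.Hist × G.GChoice) × G.Stage → ℝ≥0∞)) :=
    measurable_one.indicator hp.compl
  have h0 := lintegral_playLaw_succ σ δ N hF
  have h1 : ∫⁻ ρ, ∫⁻ x,
      {r | p r}ᶜ.indicator (1 : (G.Hist × G.GChoice) × G.Stage → ℝ≥0∞) (histAt N ρ, x)
      ∂stepKernel σ δ (histAt N ρ) ∂playLaw σ δ = 0 := by
    refine (lintegral_congr_ae (h.mono fun ρ hρ => ?_)).trans lintegral_zero
    refine (lintegral_congr_ae (hρ.mono fun x hx => ?_)).trans lintegral_zero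
    simp [hx]
  have hF' : Measurable fun ρ : ℕ → G.Stage =>
      {r | p r}ᶜ.indicator (1 : (G.Hist × G.GChoice) × G.Stage → ℝ≥0∞)
        (histAt N ρ, ρ (N + 1)) :=
    hF.comp ((measurable_histAt N).prodMk (measurable_pi_apply _))
  rw [h1, lintegral_eq_zero_iff hF'] at h0
  filter_upwards [h0] with ρ hρ
  by_contra hn
  simp [hn] at hρ

theorem map_zero_playLaw (σ : ∀ j, G.Strategy j) (δ : G.Scheduler) :
    (playLaw σ δ).map (fun ρ => ρ 0) = initLaw σ := by
  have h : (playLaw σ δ).map (Preorder.frestrictLe 0) =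
      (initLaw σ).map (MeasurableEquiv.piUnique fun _ : Finset.Iic 0 => G.Stage).symm := by
    rw [playLaw, Kernel.trajMeasure, Measure.map_comp _ _ (by fun_prop),
      Kernel.traj_map_frestrictLe, Kernel.partialTraj_self, Measure.id_comp]
  have h1 := congrArg (Measure.map fun x : Finset.Iic 0 → G.Stage => x ⟨0, by simp⟩) h
  rw [Measure.map_map (by fun_prop) (by fun_prop), Measure.map_map (by fun_prop) (by fun_prop)]
    at h1
  refine h1.trans ?_
  have h2 : (fun x : Finset.Iic 0 → G.Stage => x ⟨0, by simp⟩) ∘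
      (MeasurableEquiv.piUnique fun _ : Finset.Iic 0 => G.Stage).symm = id := rfl
  rw [h2, Measure.map_id]

/-! ### The random play follows the rules -/

/-- The transition `o` is possible in state `s` at time `t` under the choice `c`. -/
def Follows (s : G.GState) (t : ℝ) (c : G.GChoice) (o : G.Obs) : Prop :=
  (∃ a ∈ enabled c, o = (actionEvent a, t, move c a s)) ∨
    (enabled c = ∅ ∧ ∃ e : G.DelayTrans s, ∃ d : ℝ, 0 ≤ d ∧
      o = (G.delayEvent e.1, t + d, Function.update s e.1 e.2.1.2)) ∨
    (enabled c = ∅ ∧ IsEmpty (G.DelayTrans s) ∧ o = (G.noEvent, t, s))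

theorem mem_plays_iff {ρ : ℕ → G.Stage} : ρ ∈ G.plays ↔
    (ρ 0).1 = (G.noEvent, 0, G.gInit) ∧
    (∀ m j, ((ρ m).2 j).Available ((ρ m).1.2.2 j)) ∧
    (∀ m j, j ∉ sync (ρ (m + 1)).1.1 → (ρ (m + 1)).2 j = (ρ m).2 j) ∧
    ∀ m, Follows (ρ m).1.2.2 (ρ m).1.2.1 (ρ m).2 (ρ (m + 1)).1 := Iff.rfl

theorem Follows.state_of_notMem {s : G.GState} {t : ℝ} {c : G.GChoice} {o : G.Obs}
    (h : Follows s t c o) : ∀ j ∉ sync o.1, o.2.2 j = s j := by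
  intro j hj
  rcases h with ⟨a, -, rfl⟩ | ⟨-, e, d, -, rfl⟩ | ⟨-, -, rfl⟩
  · simp only at hj
    simp [move, hj]
  · have : j ≠ e.1 := fun h => hj (by subst h; exact Set.mem_singleton _)
    simp [this]
  · rfl

theorem measurableSet_follows :
    MeasurableSet {r : (G.GState × ℝ × G.GChoice) × G.Obs |
      Follows r.1.1 r.1.2.1 r.1.2.2 r.2} := by
  let π : (G.GState × ℝ × G.GChoice) × G.Obs → (G.GState × G.GChoice) × (G.Event × G.GState) :=
    fun r => ((r.1.1, r.1.2.2), (r.2.1, r.2.2.2))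
  have hπ : Measurable π := by fun_prop
  have h1 : MeasurableSet {r : (G.GState × ℝ × G.GChoice) × G.Obs | r.2.2.1 = r.1.2.1} :=
    measurableSet_eq_fun (by fun_prop) (by fun_prop)
  have h2 : MeasurableSet {r : (G.GState × ℝ × G.GChoice) × G.Obs | r.1.2.1 ≤ r.2.2.1} :=
    measurableSet_le (by fun_prop) (by fun_prop)
  let A1 : Set ((G.GState × G.GChoice) × (G.Event × G.GState)) :=
    {x | ∃ a ∈ enabled x.1.2, x.2 = (actionEvent a, move x.1.2 a x.1.1)}
  let A2 : Set ((G.GState × G.GChoice) × (G.Event × G.GState)) :=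
    {x | enabled x.1.2 = ∅ ∧ ∃ e : G.DelayTrans x.1.1,
      x.2 = (G.delayEvent e.1, Function.update x.1.1 e.1 e.2.1.2)}
  let A3 : Set ((G.GState × G.GChoice) × (G.Event × G.GState)) :=
    {x | enabled x.1.2 = ∅ ∧ IsEmpty (G.DelayTrans x.1.1) ∧ x.2 = (G.noEvent, x.1.1)}
  -- Only the comparison of the two times involves a component that is not discrete.
  have key : {r : (G.GState × ℝ × G.GChoice) × G.Obs | Follows r.1.1 r.1.2.1 r.1.2.2 r.2} =
      (π ⁻¹' A1 ∩ {r | r.2.2.1 = r.1.2.1}) ∪ ((π ⁻¹' A2 ∩ {r | r.1.2.1 ≤ r.2.2.1}) ∪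
        (π ⁻¹' A3 ∩ {r | r.2.2.1 = r.1.2.1})) := by
    ext ⟨⟨s, t, c⟩, ⟨e, t', s'⟩⟩
    simp only [Follows, Set.mem_ofPred_eq, Set.mem_union, Set.mem_inter_iff, Set.mem_preimage,
      A1, A2, A3, π, Prod.mk.injEq]
    refine or_congr (by grind) (or_congr ⟨?_, ?_⟩ (by grind))
    · rintro ⟨h, x, d, hd, h1, h2, h3⟩
      exact ⟨⟨h, x, h1, h3⟩, by linarith⟩
    · rintro ⟨⟨h, x, h1, h3⟩, ht⟩
      exact ⟨h, x, t' - t, by linarith, h1, by ring, h3⟩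
  rw [key]
  exact ((hπ MeasurableSet.of_discrete).inter h1).union
    (((hπ MeasurableSet.of_discrete).inter h2).union ((hπ MeasurableSet.of_discrete).inter h1))

theorem measurableSet_follows_comp {X : Type*} [MeasurableSpace X] {s : X → G.GState} {t : X → ℝ}
    {c : X → G.GChoice} {o : X → G.Obs} (hs : Measurable s) (ht : Measurable t)
    (hc : Measurable c) (ho : Measurable o) :
    MeasurableSet {x | Follows (s x) (t x) (c x) (o x)} :=
  measurableSet_follows.preimage ((hs.prodMk (ht.prodMk hc)).prodMk ho)

theorem measurableSet_plays : MeasurableSet G.plays := by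
  have hst (m : ℕ) : Measurable fun ρ : ℕ → G.Stage => (ρ m).1.2.2 := by fun_prop
  have hch (m : ℕ) : Measurable fun ρ : ℕ → G.Stage => (ρ m).2 := by fun_prop
  have hev (m : ℕ) : Measurable fun ρ : ℕ → G.Stage => (ρ m).1.1 := by fun_prop
  have ho (m : ℕ) : Measurable fun ρ : ℕ → G.Stage => (ρ m).1 := by fun_prop
  have ht (m : ℕ) : Measurable fun ρ : ℕ → G.Stage => (ρ m).1.2.1 := by fun_prop
  have : G.plays = {ρ | (ρ 0).1 = (G.noEvent, 0, G.gInit)} ∩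
      ((⋂ (m : ℕ) (j : Fin n), {ρ | ((ρ m).2 j).Available ((ρ m).1.2.2 j)}) ∩
      ((⋂ (m : ℕ) (j : Fin n), {ρ | j ∉ sync (ρ (m + 1)).1.1 → (ρ (m + 1)).2 j = (ρ m).2 j}) ∩
      ⋂ m : ℕ, {ρ | Follows (ρ m).1.2.2 (ρ m).1.2.1 (ρ m).2 (ρ (m + 1)).1})) := by
    ext ρ
    simp only [mem_plays_iff, Set.mem_inter_iff, Set.mem_iInter, Set.mem_ofPred_eq]
  rw [this]
  refine (ho 0 (measurableSet_singleton _)).inter (((MeasurableSet.iInter fun m =>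
    MeasurableSet.iInter fun j => ?_)).inter ((MeasurableSet.iInter fun m =>
    MeasurableSet.iInter fun j => ?_).inter (MeasurableSet.iInter fun m =>
    measurableSet_follows_comp (hst m) (ht m) (hch m) (ho (m + 1)))))
  · exact ((hch m).prodMk (hst m)) (MeasurableSet.of_discrete (s := {x : G.GChoice × G.GState |
      (x.1 j).Available (x.2 j)}))
  · exact ((hev (m + 1)).prodMk ((hch (m + 1)).prodMk (hch m))) (MeasurableSet.of_discrete
      (s := {x : G.Event × G.GChoice × G.GChoice | j ∉ sync x.1 → x.2.1 j = x.2.2 j}))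

theorem ae_expMeasure_nonneg (r : ℝ) : ∀ᵐ x ∂expMeasure r, 0 ≤ x := by
  have : expMeasure r (Set.Iio 0) = 0 := by
    rw [expMeasure, gammaMeasure, withDensity_apply _ measurableSet_Iio]
    exact lintegral_exponentialPDF_of_nonpos le_rfl
  rw [ae_iff]
  simp only [not_le]
  exact this

theorem ae_follows_transLaw (δ : G.Scheduler) (h : G.Hist) (c : G.GChoice) :
    ∀ᵐ o ∂transLaw δ h c, Follows h.last h.time c o := by
  have hm : MeasurableSet {o | Follows h.last h.time c o} :=
    measurableSet_follows_comp measurable_const measurable_const measurable_const measurable_id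
  unfold transLaw
  split
  · rename_i p hp
    rw [ae_map_iff Measurable.of_discrete.aemeasurable hm]
    filter_upwards [ae_mem_support p] with a ha
    exact Or.inl ⟨a, δ.mem_enabled h c p hp a ha, rfl⟩
  · rename_i hp
    have hc := (δ.eq_none_iff h c).1 hp
    split_ifs with hne
    · have hd : Measurable (delayObs h.last h.time) :=
        (measurable_delayObs h.last).comp measurable_prodMk_left
      rw [ae_map_iff hd.aemeasurable hm]
      have : ∀ᵐ d ∂Measure.pi fun e : G.DelayTrans h.last => expMeasure (e.2.1.1 : ℝ),
          ∀ e, 0 ≤ d e := ae_all_iff.2 fun e =>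
        Measure.tendsto_eval_ae_ae.eventually (ae_expMeasure_nonneg _)
      filter_upwards [this] with d hd
      exact Or.inr (Or.inl ⟨hc, winner d, d (winner d), hd _, rfl⟩)
    · rw [ae_dirac_iff hm]
      exact Or.inr (Or.inr ⟨hc, not_nonempty_iff.1 hne, rfl⟩)

/-- The step from `q` to `x` follows the rules. -/
def StepOK (q : G.Hist × G.GChoice) (x : G.Stage) : Prop :=
  Follows q.1.last q.1.time q.2 x.1 ∧ (∀ j ∉ sync x.1.1, x.2 j = q.2 j) ∧
    ∀ j, (x.2 j).Available (x.1.2.2 j)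

theorem measurableSet_stepOK :
    MeasurableSet {r : (G.Hist × G.GChoice) × G.Stage | StepOK r.1 r.2} := by
  have hl : Measurable fun r : (G.Hist × G.GChoice) × G.Stage => r.1.1.last :=
    measurable_last.comp (by fun_prop)
  have ht : Measurable fun r : (G.Hist × G.GChoice) × G.Stage => r.1.1.time :=
    measurable_time.comp (by fun_prop)
  refine (measurableSet_follows_comp hl ht (by fun_prop) (by fun_prop)).inter
    (MeasurableSet.inter ?_ ?_)
  · have : Measurable fun r : (G.Hist × G.GChoice) × G.Stage => (r.2.1.1, r.2.2, r.1.2) := by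
      fun_prop
    exact this (MeasurableSet.of_discrete (s := {x : G.Event × G.GChoice × G.GChoice |
      ∀ j ∉ sync x.1, x.2.1 j = x.2.2 j}))
  · have : Measurable fun r : (G.Hist × G.GChoice) × G.Stage => (r.2.2, r.2.1.2.2) := by
      fun_prop
    exact this (MeasurableSet.of_discrete (s := {x : G.GChoice × G.GState |
      ∀ j, (x.1 j).Available (x.2 j)}))

theorem ae_stepOK (σ : ∀ j, G.Strategy j) (δ : G.Scheduler) {q : G.Hist × G.GChoice}
    (hv : Valid q) : ∀ᵐ x ∂stepKernel σ δ q, StepOK q x := by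
  have hm : MeasurableSet {x | StepOK q x} := measurableSet_stepOK.preimage measurable_prodMk_left
  refine (Kernel.ae_compProd_iff hm).2 ?_
  change ∀ᵐ o ∂transLaw δ q.1 q.2, ∀ᵐ c' ∂choiceLaw σ (q.1.extend q.2 o) q.2, StepOK q (o, c')
  filter_upwards [ae_follows_transLaw δ q.1 q.2] with o ho
  filter_upwards [ae_valid_extend σ hv ho.state_of_notMem,
    ae_choiceLaw_eq σ (q.1.extend q.2 o) q.2] with c' h1 h2
  rw [Hist.active_extend] at h2
  refine ⟨ho, h2, fun j => ?_⟩
  have := h1 j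
  rwa [Hist.last_extend] at this

theorem ae_initLaw (σ : ∀ j, G.Strategy j) : ∀ᵐ x ∂initLaw σ,
    x.1 = (G.noEvent, 0, G.gInit) ∧ ∀ j, (x.2 j).Available (x.1.2.2 j) := by
  have h1 : ∀ᵐ c ∂choiceLaw σ (G.gInit, []) default, ∀ j, (c j).Available (G.gInit j) :=
    (ae_choiceLaw_available σ (G.gInit, []) default).mono fun c hc j => by
      simpa [Hist.active, Hist.local, LocalHist.last] using hc j
  have h2 : ∀ᵐ o ∂Measure.dirac ((G.noEvent, 0, G.gInit) : G.Obs), o = (G.noEvent, 0, G.gInit) :=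
    (ae_dirac_iff (measurableSet_singleton _)).2 rfl
  filter_upwards [Measure.quasiMeasurePreserving_fst.ae h2,
    Measure.quasiMeasurePreserving_snd.ae h1] with x hx1 hx2
  exact ⟨hx1, by simpa [hx1] using hx2⟩

theorem ae_zero_playLaw (σ : ∀ j, G.Strategy j) (δ : G.Scheduler) : ∀ᵐ ρ ∂playLaw σ δ,
    (ρ 0).1 = (G.noEvent, 0, G.gInit) ∧ ∀ j, ((ρ 0).2 j).Available ((ρ 0).1.2.2 j) := by
  have h := ae_initLaw σ
  rw [← map_zero_playLaw σ δ] at h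
  exact ae_of_ae_map (measurable_pi_apply 0).aemeasurable h

theorem ae_valid_histAt (σ : ∀ j, G.Strategy j) (δ : G.Scheduler) (N : ℕ) :
    ∀ᵐ ρ ∂playLaw σ δ, Valid (histAt N ρ) := by
  induction N with
  | zero =>
    filter_upwards [ae_zero_playLaw σ δ] with ρ hρ j
    rw [histAt_last]
    exact hρ.2 j
  | succ N ih =>
    filter_upwards [ae_playLaw_succ σ δ N (p := fun r => StepOK r.1 r.2) measurableSet_stepOK
      (ih.mono fun ρ hρ => ae_stepOK σ δ hρ)] with ρ hρ j
    rw [histAt_last]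
    exact hρ.2.2 j

theorem ae_stepOK_histAt (σ : ∀ j, G.Strategy j) (δ : G.Scheduler) (N : ℕ) :
    ∀ᵐ ρ ∂playLaw σ δ, StepOK (histAt N ρ) (ρ (N + 1)) :=
  ae_playLaw_succ σ δ N (p := fun r => StepOK r.1 r.2) measurableSet_stepOK
    ((ae_valid_histAt σ δ N).mono fun _ hρ => ae_stepOK σ δ hρ)

theorem ae_mem_plays (σ : ∀ j, G.Strategy j) (δ : G.Scheduler) :
    ∀ᵐ ρ ∂playLaw σ δ, ρ ∈ G.plays := by
  filter_upwards [ae_zero_playLaw σ δ, ae_all_iff.2 (ae_valid_histAt σ δ),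
    ae_all_iff.2 (ae_stepOK_histAt σ δ)] with ρ h0 hv hs
  refine mem_plays_iff.2 ⟨h0.1, fun m j => ?_, fun m => (hs m).2.1, fun m => ?_⟩
  · have := hv m j
    rwa [histAt_last] at this
  · have := (hs m).1
    rwa [histAt_last, histAt_time m (by rw [h0.1])] at this

theorem valid_histAt {ρ : ℕ → G.Stage} (hρ : ρ ∈ G.plays) (N : ℕ) : Valid (histAt N ρ) := by
  intro j
  rw [histAt_last]
  exact (mem_plays_iff.1 hρ).2.1 N j

/-! ### The probability of reaching a target -/

section Reach

variable (σ : ∀ j, G.Strategy j) (δ : G.Scheduler) {U : Set (G.Hist × G.GChoice)}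

theorem lintegral_histAt_succ (N : ℕ) {g : G.Hist × G.GChoice → ℝ≥0∞} (hg : Measurable g) :
    ∫⁻ ρ, g (histAt (N + 1) ρ) ∂playLaw σ δ = ∫⁻ ρ, stepVal σ δ g (histAt N ρ) ∂playLaw σ δ := by
  have hF : Measurable fun r : (G.Hist × G.GChoice) × G.Stage =>
      g (r.1.1.extend r.1.2 r.2.1, r.2.2) :=
    hg.comp ((measurable_extend.comp (by fun_prop :
      Measurable fun r : (G.Hist × G.GChoice) × G.Stage => (r.1, r.2.1))).prodMk (by fun_prop))
  simp only [histAt_succ]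
  rw [lintegral_playLaw_succ σ δ N hF]
  refine lintegral_congr fun ρ => ?_
  exact Kernel.lintegral_compProd _ _ _ (hF.comp measurable_prodMk_left)

/-- The set of plays with a prefix in `U`. -/
def reach (U : Set (G.Hist × G.GChoice)) : Set (ℕ → G.Stage) :=
  {ρ | ρ ∈ G.plays ∧ ∃ N, histAt N ρ ∈ U}

theorem IsTarget.histAt_mem_of_le (hU : IsTarget U) {ρ : ℕ → G.Stage} (hρ : ρ ∈ G.plays) {N M : ℕ}
    (hNM : N ≤ M) (h : histAt N ρ ∈ U) : histAt M ρ ∈ U := by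
  induction M, hNM using Nat.le_induction with
  | base => exact h
  | succ M _ ih =>
    rw [histAt_succ]
    exact hU.extend _ _ _ _ ih fun j hj => (mem_plays_iff.1 hρ).2.2.1 M j hj

theorem IsTarget.measurableSet_reach (hU : IsTarget U) : MeasurableSet (reach U) := by
  have : reach U = G.plays ∩ ⋃ N, histAt N ⁻¹' U := by
    ext ρ
    simp [reach]
  rw [this]
  exact measurableSet_plays.inter (MeasurableSet.iUnion fun N =>
    measurable_histAt N hU.measurableSet)

theorem IsTarget.playLaw_reach_eq_iSup (hU : IsTarget U) :
    playLaw σ δ (reach U) = ⨆ N, ∫⁻ ρ, ind U (histAt N ρ) ∂playLaw σ δ := by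
  have h1 : reach U = ⋃ N, G.plays ∩ histAt N ⁻¹' U := by
    ext ρ
    simp [reach]
  have hmono : Monotone fun N => G.plays ∩ histAt N ⁻¹' U :=
    fun N M hNM ρ hρ => ⟨hρ.1, hU.histAt_mem_of_le hρ.1 hNM hρ.2⟩
  rw [h1, hmono.measure_iUnion]
  refine iSup_congr fun N => ?_
  rw [Measure.measure_inter_eq_of_ae (ae_mem_plays σ δ),
    ← lintegral_indicator_one (measurable_histAt N hU.measurableSet)]
  rfl

/-- Under every scheduler the probability of reaching a target is given by `reachVal`. The iterates
of the infimum operator bound it from below, and `reachVal` bounds it from above as it is a fixed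
point of the one-step expectation under `δ`. -/
theorem IsTarget.playLaw_reach (hU : IsTarget U) (hG : G.NoActionCycles) :
    playLaw σ δ (reach U) = ∫⁻ x, reachVal σ U ((x.1.2.2, []), x.2) ∂initLaw σ := by
  have hstart : ∫⁻ x, reachVal σ U ((x.1.2.2, []), x.2) ∂initLaw σ =
      ∫⁻ ρ, reachVal σ U (histAt 0 ρ) ∂playLaw σ δ := by
    rw [← map_zero_playLaw σ δ, lintegral_map _ (measurable_pi_apply 0)]
    · simp only [histAt_zero]
    · exact (hU.measurable_reachVal σ δ).comp (by fun_prop)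
  rw [hU.playLaw_reach_eq_iSup, hstart]
  apply le_antisymm
  · refine iSup_le fun N => ?_
    -- As a fixed point, `reachVal` has constant expectation along the play.
    have h1 : ∫⁻ ρ, reachVal σ U (histAt N ρ) ∂playLaw σ δ =
        ∫⁻ ρ, reachVal σ U (histAt 0 ρ) ∂playLaw σ δ := by
      induction N with
      | zero => rfl
      | succ N ih =>
        rw [lintegral_histAt_succ σ δ N (hU.measurable_reachVal σ δ), ← ih]
        refine lintegral_congr_ae ((ae_mem_plays σ δ).mono fun ρ hρ => ?_)
        exact stepVal_eq_of_infVal_eq hG σ δ (hU.measurable_reachVal σ δ)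
          (hU.invariant_reachVal σ) (hU.infVal_reachVal σ δ) (valid_histAt hρ N)
    rw [← h1]
    refine lintegral_mono fun ρ => ?_
    exact le_iSup (fun N => (infVal σ)^[N] (ind U)) 0 _
  · -- The scheduler `δ` does at least as well as the minimizing one in each of `N` steps.
    have h1 (N : ℕ) : ∀ M, ∫⁻ ρ, (infVal σ)^[N] (ind U) (histAt M ρ) ∂playLaw σ δ ≤
        ∫⁻ ρ, ind U (histAt (M + N) ρ) ∂playLaw σ δ := by
      induction N with
      | zero => exact fun M => le_rfl
      | succ N ih =>
        intro M
        have hm := hU.measurable_iterate σ δ N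
        calc ∫⁻ ρ, (infVal σ)^[N + 1] (ind U) (histAt M ρ) ∂playLaw σ δ
            ≤ ∫⁻ ρ, stepVal σ δ ((infVal σ)^[N] (ind U)) (histAt M ρ) ∂playLaw σ δ := by
              refine lintegral_mono fun ρ => ?_
              rw [Function.iterate_succ_apply']
              exact infVal_le_stepVal σ δ hm _
          _ = ∫⁻ ρ, (infVal σ)^[N] (ind U) (histAt (M + 1) ρ) ∂playLaw σ δ :=
              (lintegral_histAt_succ σ δ M hm).symm
          _ ≤ _ := by
              rw [← Nat.add_assoc, Nat.add_right_comm]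
              exact ih (M + 1)
    simp only [reachVal, iSup_apply]
    rw [lintegral_iSup (f := fun N ρ => (infVal σ)^[N] (ind U) (histAt 0 ρ))
      (fun N => (hU.measurable_iterate σ δ N).comp (measurable_histAt 0))
      fun i k hik ρ => hU.monotone_iterate σ δ hik _]
    refine iSup_mono fun N => ?_
    simpa using h1 N 0

theorem isPiSystem_reach :
    IsPiSystem {S : Set (ℕ → G.Stage) | ∃ U, IsTarget U ∧ reach U = S} := by
  rintro _ ⟨U, hU, rfl⟩ _ ⟨V, hV, rfl⟩ -
  refine ⟨U ∩ V, ⟨hU.measurableSet.inter hV.measurableSet, fun h h' c hh => ?_,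
    fun h c o c' hq hc => ⟨hU.extend h c o c' hq.1 hc, hV.extend h c o c' hq.2 hc⟩⟩, ?_⟩
  · simp only [Set.mem_inter_iff, hU.invariant c hh, hV.invariant c hh]
  · ext ρ
    constructor
    · rintro ⟨hρ, N, h1, h2⟩
      exact ⟨⟨hρ, N, h1⟩, hρ, N, h2⟩
    · rintro ⟨⟨hρ, N, h1⟩, -, M, h2⟩
      exact ⟨hρ, max N M, hU.histAt_mem_of_le hρ (le_max_left _ _) h1,
        hV.histAt_mem_of_le hρ (le_max_right _ _) h2⟩

/-- The laws of the play under two schedulers agree on the `σ`-algebra generated by the reachability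
of targets. -/
theorem playLaw_eq_of_measurableSet_generateFrom (hG : G.NoActionCycles) (δ' : G.Scheduler)
    {S : Set (ℕ → G.Stage)}
    (hS : MeasurableSet[MeasurableSpace.generateFrom
      {S : Set (ℕ → G.Stage) | ∃ U, IsTarget U ∧ reach U = S}] S) :
    playLaw σ δ S = playLaw σ δ' S := by
  refine ext_on_measurableSpace_of_generate_finite _ _ ?_ ?_ rfl isPiSystem_reach (by simp) hS
  · rintro _ ⟨U, hU, rfl⟩
    rw [hU.playLaw_reach σ δ hG, hU.playLaw_reach σ δ' hG]
  · refine MeasurableSpace.generateFrom_le ?_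
    rintro _ ⟨U, hU, rfl⟩
    exact hU.measurableSet_reach

end Reach

/-! ### Targets that determine the local plays -/

theorem measurableSet_getElem? {X : Type*} [MeasurableSpace X] (i : ℕ) {B : Set X}
    (hB : MeasurableSet B) : MeasurableSet {l : List X | ∃ x, l[i]? = some x ∧ x ∈ B} := by
  refine measurableSet_list_iff.2 fun k => ?_
  by_cases hi : i < k
  · convert measurable_pi_apply (X := fun _ : Fin k => X) ⟨i, hi⟩ hB using 1
    ext w
    simp [hi]
  · convert MeasurableSet.empty
    ext w
    simp [hi]

theorem measurable_length {X : Type*} [MeasurableSpace X] :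
    Measurable (List.length : List X → ℕ) :=
  measurable_list_iff.2 fun k => by simp

/-- A property of the local history and the current choice of one player defines a target if it
persists when a local step is added. -/
theorem isTarget_local (j : Fin n) {A : Set (G.LocalHist j × (G.comp j).Choice)}
    (hA : MeasurableSet A)
    (hext : ∀ s l c x c', ((s, l), c) ∈ A → x.1 = c → ((s, l ++ [x]), c') ∈ A) :
    IsTarget {p : G.Hist × G.GChoice | (p.1.local j, p.2 j) ∈ A} where
  measurableSet := (((measurable_local j).comp measurable_fst).prodMk
    ((measurable_pi_apply j).comp measurable_snd)) hA
  invariant h h' c hh := by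
    simp only [Set.mem_ofPred_eq, hh.locals]
  extend h c o c' hq hc := by
    simp only [Set.mem_ofPred_eq] at hq ⊢
    by_cases hj : j ∈ sync o.1
    · rw [Hist.local_extend_of_mem _ _ _ hj]
      exact hext _ _ _ _ _ hq rfl
    · rwa [Hist.local_extend_of_notMem _ _ _ hj, hc j hj]

/-- The local step with index `i` of player `j` has label `e`, time less than `q` and target `s`. -/
def stepTarget (j : Fin n) (i : ℕ) (e : G.Event) (q : ℚ) (s : (G.comp j).State) :
    Set (G.Hist × G.GChoice) :=
  {p | ∃ x, (p.1.local j).2[i]? = some x ∧ x.2.1 = e ∧ x.2.2.1 < q ∧ x.2.2.2 = s}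

/-- The choice of player `j` between its local steps with indices `i - 1` and `i` is `x`. It is
recorded with the latter step, and is the current choice if there is no such step yet. -/
def choiceTarget (j : Fin n) (i : ℕ) (x : (G.comp j).Choice) : Set (G.Hist × G.GChoice) :=
  {p | (∃ y, (p.1.local j).2[i]? = some y ∧ y.1 = x) ∨ ((p.1.local j).2.length = i ∧ p.2 j = x)}

theorem isTarget_stepTarget (j : Fin n) (i : ℕ) (e : G.Event) (q : ℚ) (s : (G.comp j).State) :
    IsTarget (stepTarget j i e q s) := by
  let B : Set ((G.comp j).Choice × G.Event × ℝ × (G.comp j).State) :=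
    {x | x.2.1 = e ∧ x.2.2.1 < q ∧ x.2.2.2 = s}
  have hB : MeasurableSet B := by
    refine MeasurableSet.inter ?_ (MeasurableSet.inter ?_ ?_)
    · exact (measurable_fst.comp measurable_snd) (measurableSet_singleton e)
    · exact measurableSet_lt (measurable_fst.comp (measurable_snd.comp measurable_snd))
        measurable_const
    · exact (measurable_snd.comp (measurable_snd.comp measurable_snd)) (measurableSet_singleton s)
  refine isTarget_local j (A := {r | ∃ x, r.1.2[i]? = some x ∧ x ∈ B})
    ((measurable_snd.comp measurable_fst) (measurableSet_getElem? i hB)) ?_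
  rintro s l c x c' ⟨y, hy, hyB⟩ -
  obtain ⟨hi, -⟩ := List.getElem?_eq_some_iff.1 hy
  exact ⟨y, by simpa only [List.getElem?_append_left hi] using hy, hyB⟩

theorem isTarget_choiceTarget (j : Fin n) (i : ℕ) (x : (G.comp j).Choice) :
    IsTarget (choiceTarget j i x) := by
  refine isTarget_local j (A := {r | (∃ y, r.1.2[i]? = some y ∧ y.1 = x) ∨
    (r.1.2.length = i ∧ r.2 = x)}) (MeasurableSet.union ?_ (MeasurableSet.inter ?_ ?_)) ?_
  · exact (measurable_snd.comp measurable_fst)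
      (measurableSet_getElem? i (measurable_fst (measurableSet_singleton x)))
  · exact (measurable_length.comp (measurable_snd.comp measurable_fst))
      (measurableSet_singleton i)
  · exact measurable_snd (measurableSet_singleton x)
  · rintro s l c y c' (⟨z, hz, hzx⟩ | ⟨hl, hc⟩) hy
    · obtain ⟨hi, -⟩ := List.getElem?_eq_some_iff.1 hz
      exact Or.inl ⟨z, by simpa only [List.getElem?_append_left hi] using hz, hzx⟩
    · simp only at hl hc
      subst hl
      exact Or.inl ⟨y, by simp, hy.trans hc⟩

/-! ### Local plays and local histories -/

theorem visible_zero (j : Fin n) (ρ : ℕ → G.Stage) : Visible j ρ 0 := Or.inl rfl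

theorem visible_succ (j : Fin n) (ρ : ℕ → G.Stage) (m : ℕ) :
    Visible j ρ (m + 1) ↔ j ∈ sync (ρ (m + 1)).1.1 := by
  simp [Visible]

open Classical in
/-- The length of the local history is one less than the number of visible stages, as the start is
visible, too. -/
theorem length_local_histAt (j : Fin n) (ρ : ℕ → G.Stage) (N : ℕ) :
    ((histAt N ρ).1.local j).2.length + 1 = Nat.count (Visible j ρ) (N + 1) := by
  induction N with
  | zero => simp [histAt_zero, Hist.local, Nat.count_succ, visible_zero]
  | succ N ih =>
    rw [Nat.count_succ, ← ih, histAt_succ]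
    by_cases hj : j ∈ sync (ρ (N + 1)).1.1
    · rw [Hist.local_extend_of_mem _ _ _ hj, if_pos ((visible_succ j ρ N).2 hj)]
      simp
    · rw [Hist.local_extend_of_notMem _ _ _ hj, if_neg (mt (visible_succ j ρ N).1 hj)]

open Classical in
theorem getElem?_local_histAt (j : Fin n) (ρ : ℕ → G.Stage) (N i : ℕ) :
    ((histAt N ρ).1.local j).2[i]? = if i + 1 < Nat.count (Visible j ρ) (N + 1) then
      some ((ρ (Nat.nth (Visible j ρ) (i + 1) - 1)).2 j,
        (ρ (Nat.nth (Visible j ρ) (i + 1))).1.1, (ρ (Nat.nth (Visible j ρ) (i + 1))).1.2.1,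
        (ρ (Nat.nth (Visible j ρ) (i + 1))).1.2.2 j)
      else none := by
  induction N with
  | zero => simp [histAt_zero, Hist.local, Nat.count_succ, visible_zero]
  | succ N ih =>
    have hlen := length_local_histAt j ρ N
    rw [Nat.count_succ _ (N + 1), histAt_succ]
    by_cases hj : j ∈ sync (ρ (N + 1)).1.1
    · have hv : Visible j ρ (N + 1) := Or.inr hj
      rw [Hist.local_extend_of_mem _ _ _ hj, if_pos hv, List.getElem?_append]
      rcases lt_trichotomy i ((histAt N ρ).1.local j).2.length with h | h | h
      · rw [if_pos h, ih, if_pos (by omega), if_pos (by omega)]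
      · have hn : Nat.nth (Visible j ρ) (i + 1) = N + 1 := by
          rw [h, hlen, Nat.nth_count hv]
        rw [if_neg (by omega), if_pos (by omega), hn, h]
        simp [histAt_choice]
      · rw [if_neg (by omega), if_neg (by omega), List.getElem?_eq_none]
        simp
        omega
    · rw [Hist.local_extend_of_notMem _ _ _ hj, if_neg (mt (visible_succ j ρ N).1 hj), ih]
      simp only [Nat.add_zero]

theorem lt_card_of_lt_encard {p : ℕ → Prop} {k : ℕ} (h : (k : ℕ∞) < {m | p m}.encard)
    (hf : (Set.ofPred p).Finite) : k < hf.toFinset.card := by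
  have h1 : {m | p m}.encard = hf.toFinset.card := hf.encard_eq_coe_toFinset_card
  rw [h1] at h
  exact_mod_cast h

open Classical in
theorem lt_encard_of_lt_count {p : ℕ → Prop} {k N : ℕ} (h : k < Nat.count p N) :
    (k : ℕ∞) < {m | p m}.encard := by
  have h1 : ((Finset.range N).filter p : Set ℕ) ⊆ {m | p m} := fun m hm => by
    simp only [Finset.coe_filter, Set.mem_ofPred_eq] at hm
    exact hm.2
  have h2 := Set.encard_le_encard h1
  rw [Set.encard_coe_eq_coe_finsetCard, ← Nat.count_eq_card_filter_range] at h2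
  exact lt_of_lt_of_le (by exact_mod_cast h) h2

open Classical in
/-- Between visible stages a player keeps its choice. -/
theorem choice_eq_of_mem_plays (j : Fin n) {ρ : ℕ → G.Stage} (hρ : ρ ∈ G.plays) {N k : ℕ}
    (h : Nat.count (Visible j ρ) (N + 1) = k + 1) :
    (ρ N).2 j = (ρ (Nat.nth (Visible j ρ) k)).2 j := by
  induction N with
  | zero =>
    have : k = 0 := by simpa [Nat.count_succ, visible_zero] using h.symm
    rw [this, Nat.nth_zero_of_zero (visible_zero j ρ)]
  | succ N ih =>
    rw [Nat.count_succ] at h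
    by_cases hj : j ∈ sync (ρ (N + 1)).1.1
    · have hv : Visible j ρ (N + 1) := Or.inr hj
      rw [if_pos hv] at h
      rw [← Nat.succ_injective h, Nat.nth_count hv]
    · rw [if_neg (mt (visible_succ j ρ N).1 hj)] at h
      rw [← ih h, (mem_plays_iff.1 hρ).2.2.1 N j hj]

theorem mem_reach_stepTarget (j : Fin n) {ρ : ℕ → G.Stage} (hρ : ρ ∈ G.plays) (i : ℕ)
    (e : G.Event) (q : ℚ) (s : (G.comp j).State) : ρ ∈ reach (stepTarget j i e q s) ↔
      ∃ y, localPlay j ρ (i + 1) = some y ∧ y.1 = e ∧ y.2.1 < q ∧ y.2.2.1 = s := by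
  classical
  constructor
  · rintro ⟨-, N, x, hx, hxe⟩
    rw [getElem?_local_histAt] at hx
    split_ifs at hx with hc
    rw [Option.some_inj] at hx
    subst hx
    exact ⟨_, if_pos (lt_encard_of_lt_count hc), hxe⟩
  · rintro ⟨y, hy, hye⟩
    unfold localPlay at hy
    split_ifs at hy with hc
    rw [Option.some_inj] at hy
    subst hy
    refine ⟨hρ, Nat.nth (Visible j ρ) (i + 1),
      ((ρ (Nat.nth (Visible j ρ) (i + 1) - 1)).2 j, _, _, _), ?_, hye⟩
    rw [getElem?_local_histAt, if_pos]
    rw [Nat.count_nth_succ (lt_card_of_lt_encard hc)]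
    omega

theorem mem_reach_choiceTarget (j : Fin n) {ρ : ℕ → G.Stage} (hρ : ρ ∈ G.plays) (i : ℕ)
    (x : (G.comp j).Choice) : ρ ∈ reach (choiceTarget j i x) ↔
      ∃ y, localPlay j ρ i = some y ∧ y.2.2.2 = x := by
  classical
  constructor
  · rintro ⟨-, N, ⟨y, hy, hyx⟩ | ⟨hl, hx⟩⟩
    · rw [getElem?_local_histAt] at hy
      split_ifs at hy with hc
      rw [Option.some_inj] at hy
      have hcard := lt_card_of_lt_encard (lt_encard_of_lt_count hc)
      have hpos : 0 < Nat.nth (Visible j ρ) (i + 1) :=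
        (Nat.zero_le _).trans_lt (Nat.nth_lt_nth' (Nat.succ_pos i) hcard)
      refine ⟨_, if_pos (lt_encard_of_lt_count (i.lt_succ_self.trans hc)), ?_⟩
      rw [← hyx, ← hy]
      refine (choice_eq_of_mem_plays j hρ ?_).symm
      rw [Nat.sub_add_cancel hpos, Nat.count_nth hcard]
    · have hcount := length_local_histAt j ρ N
      rw [hl] at hcount
      refine ⟨_, if_pos (lt_encard_of_lt_count (N := N + 1) (by omega)), ?_⟩
      rw [← hx, histAt_choice]
      exact (choice_eq_of_mem_plays j hρ hcount.symm).symm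
  · rintro ⟨y, hy, hyx⟩
    unfold localPlay at hy
    split_ifs at hy with hc
    rw [Option.some_inj] at hy
    subst hy
    refine ⟨hρ, Nat.nth (Visible j ρ) i, Or.inr ⟨?_, hyx⟩⟩
    have := length_local_histAt j ρ (Nat.nth (Visible j ρ) i)
    rw [Nat.count_nth_succ (lt_card_of_lt_encard hc)] at this
    omega

theorem localPlay_zero (j : Fin n) {ρ : ℕ → G.Stage} (hρ : ρ ∈ G.plays) :
    localPlay j ρ 0 = some (G.noEvent, 0, G.gInit j, (ρ 0).2 j) := by
  classical
  have h0 := visible_zero j ρ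
  unfold localPlay
  rw [if_pos (lt_encard_of_lt_count (N := 1) (by simp [Nat.count_succ, h0]))]
  simp only [Nat.nth_zero_of_zero h0, (mem_plays_iff.1 hρ).1]

variable (G) in
/-- The indices of a countable family of targets. -/
abbrev TargetIndex : Type (max u v) :=
  (Σ j : Fin n, ℕ × G.Event × ℚ × (G.comp j).State) ⊕ (Σ j : Fin n, ℕ × (G.comp j).Choice)

/-- A countable family of targets that determines the local plays. -/
def target : G.TargetIndex → Set (G.Hist × G.GChoice)
  | .inl ⟨j, i, e, q, s⟩ => stepTarget j i e q s
  | .inr ⟨j, i, x⟩ => choiceTarget j i x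

theorem isTarget_target (k : G.TargetIndex) : IsTarget (target k) := by
  rcases k with ⟨j, i, e, q, s⟩ | ⟨j, i, x⟩
  · exact isTarget_stepTarget j i e q s
  · exact isTarget_choiceTarget j i x

theorem localPlay_le_of_reach {ρ ρ' : ℕ → G.Stage} (hρ : ρ ∈ G.plays) (hρ' : ρ' ∈ G.plays)
    (h : ∀ k : G.TargetIndex, ρ ∈ reach (target k) → ρ' ∈ reach (target k)) (j : Fin n) (i : ℕ)
    {y} (hy : localPlay j ρ i = some y) : ∃ y', localPlay j ρ' i = some y' ∧
      y'.1 = y.1 ∧ y'.2.1 ≤ y.2.1 ∧ y'.2.2 = y.2.2 := by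
  obtain ⟨y', hy', hc⟩ := (mem_reach_choiceTarget j hρ' i y.2.2.2).1
    (h (.inr ⟨j, i, y.2.2.2⟩) ((mem_reach_choiceTarget j hρ i _).2 ⟨y, hy, rfl⟩))
  refine ⟨y', hy', ?_⟩
  cases i with
  | zero =>
    rw [localPlay_zero j hρ, Option.some_inj] at hy
    rw [localPlay_zero j hρ', Option.some_inj] at hy'
    subst hy hy'
    exact ⟨rfl, le_rfl, Prod.ext rfl hc⟩
  | succ i =>
    have key (q : ℚ) (hq : y.2.1 < q) : y'.1 = y.1 ∧ y'.2.1 < q ∧ y'.2.2.1 = y.2.2.1 := by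
      obtain ⟨z, hz, hzy⟩ := (mem_reach_stepTarget j hρ' i y.1 q y.2.2.1).1
        (h (.inl ⟨j, i, y.1, q, y.2.2.1⟩)
          ((mem_reach_stepTarget j hρ i _ _ _).2 ⟨y, hy, rfl, hq, rfl⟩))
      rw [hy', Option.some_inj] at hz
      rwa [hz]
    obtain ⟨q, hq⟩ := exists_rat_gt y.2.1
    exact ⟨(key q hq).1, le_of_forall_lt_rat_imp_le fun q hq => (key q hq).2.1.le,
      Prod.ext (key q hq).2.2 hc⟩

theorem locallyEquivalent_of_reach {ρ ρ' : ℕ → G.Stage} (hρ : ρ ∈ G.plays) (hρ' : ρ' ∈ G.plays)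
    (h : ∀ k : G.TargetIndex, ρ ∈ reach (target k) ↔ ρ' ∈ reach (target k)) :
    LocallyEquivalent ρ ρ' := by
  intro j
  funext i
  refine Option.ext fun y => ?_
  suffices H : ∀ {ρ ρ' : ℕ → G.Stage}, ρ ∈ G.plays → ρ' ∈ G.plays →
      (∀ k : G.TargetIndex, ρ ∈ reach (target k) ↔ ρ' ∈ reach (target k)) →
      localPlay j ρ i = some y → localPlay j ρ' i = some y from
    ⟨H hρ hρ' h, H hρ' hρ fun k => (h k).symm⟩
  intro ρ ρ' hρ hρ' h hy
  obtain ⟨y', hy', h1, h2, h3⟩ := localPlay_le_of_reach hρ hρ' (fun k => (h k).1) j i hy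
  obtain ⟨z, hz, -, h4, -⟩ := localPlay_le_of_reach hρ' hρ (fun k => (h k).2) j i hy'
  rw [hy, Option.some_inj] at hz
  subst hz
  rw [hy']
  exact congrArg some (Prod.ext h1 (Prod.ext (le_antisymm h2 h4) h3))

/-! ### Sets of plays closed under local observation equivalence -/

/-- By Blackwell's theorem, a measurable set of plays that is a union of atoms of a countably
generated `σ`-algebra belongs to that `σ`-algebra. -/
theorem exists_measurableSet_reach {E : Set (ℕ → G.Stage)} (hplays : E ⊆ G.plays)
    (hmeas : MeasurableSet E)
    (hclosed : ∀ ρ ∈ E, ∀ ρ' ∈ G.plays, LocallyEquivalent ρ ρ' → ρ' ∈ E) :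
    ∃ B : Set (G.TargetIndex → Prop), MeasurableSet B ∧
      E = G.plays ∩ (fun ρ k => ρ ∈ reach (target k)) ⁻¹' B := by
  have : StandardBorelSpace G.plays := measurableSet_plays.standardBorel
  let f : G.plays → G.TargetIndex → Prop := fun ρ k => ρ.1 ∈ reach (target k)
  have hf : Measurable f := measurable_pi_iff.2 fun k =>
    measurableSet_setOfPred.1 (measurable_subtype_coe (isTarget_target k).measurableSet_reach)
  let s : Set (G.TargetIndex → Prop) := f '' (Subtype.val ⁻¹' E)
  have hs : f ⁻¹' s = Subtype.val ⁻¹' E := by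
    refine Set.Subset.antisymm ?_ (Set.subset_preimage_image f _)
    rintro ρ ⟨ρ', hρ', hff⟩
    exact hclosed ρ' hρ' ρ ρ.2 (locallyEquivalent_of_reach ρ'.2 ρ.2 fun k =>
      (congrFun hff k).to_iff)
  have hms : MeasurableSet (f ⁻¹' s) := by
    rw [hs]
    exact measurable_subtype_coe hmeas
  obtain ⟨B, hB, hBs⟩ := hf.measurableSet_preimage_iff_preimage_val.1 hms
  refine ⟨B, hB, ?_⟩
  ext ρ
  have key (hρ : ρ ∈ G.plays) : f ⟨ρ, hρ⟩ ∈ B ↔ ρ ∈ E := by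
    have h1 := Set.ext_iff.1 hBs ⟨f ⟨ρ, hρ⟩, ⟨ρ, hρ⟩, rfl⟩
    have h2 := Set.ext_iff.1 hs ⟨ρ, hρ⟩
    exact h1.trans h2
  exact ⟨fun hE => ⟨hplays hE, (key (hplays hE)).2 hE⟩, fun h => (key h.1).1 h.2⟩

end DistributedIMC

theorem mainTheorem5 {n : ℕ} {α : Type v} (G : DistributedIMC.{u, v} n α)
    (hG : G.NoActionCycles) (E : Set (ℕ → G.Stage)) (hplays : E ⊆ G.plays)
    (hmeas : MeasurableSet E)
    (hclosed : ∀ ρ ∈ E, ∀ ρ' ∈ G.plays, DistributedIMC.LocallyEquivalent ρ ρ' → ρ' ∈ E)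
    (σ : ∀ j, G.Strategy j) (δ δ' : G.Scheduler) :
    DistributedIMC.playLaw σ δ E = DistributedIMC.playLaw σ δ' E := by
  obtain ⟨B, hB, rfl⟩ := DistributedIMC.exists_measurableSet_reach hplays hmeas hclosed
  rw [Measure.measure_inter_eq_of_ae (DistributedIMC.ae_mem_plays σ δ),
    Measure.measure_inter_eq_of_ae (DistributedIMC.ae_mem_plays σ δ')]
  refine DistributedIMC.playLaw_eq_of_measurableSet_generateFrom σ δ hG δ' ?_
  let : MeasurableSpace (ℕ → G.Stage) := MeasurableSpace.generateFrom
    {S : Set (ℕ → G.Stage) | ∃ U, DistributedIMC.IsTarget U ∧ DistributedIMC.reach U = S}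
  refine measurable_pi_iff.2 (fun k => measurableSet_setOfPred.1 ?_) hB
  exact MeasurableSpace.measurableSet_generateFrom
    ⟨_, DistributedIMC.isTarget_target k, rfl⟩
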